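/- **Model.** There are finitely many products $j\in\{1,\dots,M\}$, all initially undeveloped ($U$). Product $j$ has an innovation cost $c_j\ge 0$, a probability $p_j\in[0,1]$ of being good, and rewards $r^g_j>r^b_j\ge 0$. A platform commits to a policy $\boldsymbol{\pi_p}$, which is a global entry time $T_p$, or a global entry time with a transaction fee $(T_p,\alpha)$, or a vector of entry times $(T_{p_1},\dots,T_{p_M})$. Entry times are integers $\ge 1$, $\alpha\in[0,1]$, and $\alpha=0$ in the settings without a fee. In each timestep $t=0,1,\dots$ the seller sells one product or nothing. Selling nothing pays $0$. Selling an undeveloped product $j$ costs $c_j$ and reveals the product to be good with probability $p_j$ (reward $(1-\alpha)r^g_j$ in that timestep) or bad ($B$, reward $(1-\alpha)r^b_j$). Selling a bad product pays $(1-\alpha)r^b_j$ and leaves it bad. Selling a good product pays $(1-\alpha) r^g_j$. Selling an entered product ($E$) pays $0$ and leaves it entered. A product that is revealed to be good has a counter, which is $T_{p_j}$ during the timestep of its exploration. In the seller's problem $\mathcal M$ the counter of a good product drops by one in every timestep, and the product becomes entered when its counter reaches $0$, so that the platform enters $T_{p_j}$ timesteps after the product was explored. In the *rested* problem $\mathcal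 M'$ everything is the same, except that the counter of a good product drops only in the timesteps in which that product is sold. A seller policy $\pi$ chooses the (possibly randomized) action as a function of the past actions and of the qualities that they revealed, so that the same policy can be used in both problems. $V^{\mathcal M}_\pi$ and $V^{\mathcal M'}_\pi$ denote its total expected discounted reward from the initial state, with discount factor $\gamma\in(0,1)$. The Gittins index of product $j$ in state $x$ is $$G_j(x)=\sup_{\tau\ge1}\frac{\mathbb E\left[\sum_{t<\tau}\gamma^tR_j(x_j(t))\mid x_j(0)=x\right]}{\mathbb E\left[\sum_{t<\tau}\gamma^t\mid x_j(0)=x\right]},$$ where product $j$ is sold in every timestep and $\tau$ ranges over its (possibly infinite) stopping times. Selling nothing has index $0$. A Gittins-index policy for $\mathcal M$ or $\mathcal M'$ always takes an action of largest index in the current state of that problem, with arbitrary tie-breaking. A policy *keeps selling good products* in $\mathcal M$ or $\mathcal M'$ if, almost surely, it sells product $j$ whenever $j$ is in the good state of that problem. A policy *preserves the products as independent processes* if, almost surely, in $\mathcal M$ no product changes its state in a timestep in which it is not sold. "Reached" below means reached with positive probability. **Proposition.** 1. In $\mathcal M$ a good product always changes its state (including the counter) when it is not sold. In $\mathcal M'$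 no product does. 2. $V^{\mathcal M'}_\pi\ge V^{\mathcal M}_\pi$ for every seller policy $\pi$. 3. If $\pi$ keeps selling good products in $\mathcal M$ or in $\mathcal M'$, then the two problems reach the same histories under $\pi$, their states agree along these histories, and $V^{\mathcal M'}_\pi=V^{\mathcal M}_\pi$. A policy preserves the products as independent processes if and only if it keeps selling good products in $\mathcal M$. 4. Every Gittins-index policy for $\mathcal M'$ is optimal in $\mathcal M'$. For each of $\mathcal M$, $\mathcal M'$ there is a Gittins-index policy that keeps selling good products in that problem. Every Gittins-index policy for $\mathcal M$ or $\mathcal M'$ that keeps selling good products in that problem is optimal in both $\mathcal M'$ and $\mathcal M$ and has the same value in both. 5. Suppose that for every $j$ either $c_j>0$, or both $p_j<1$ and $\alpha<1$. Then every Gittins-index policy for $\mathcal M$ or $\mathcal M'$ keeps selling good products in that problem, and so it preserves the products as independent processes, has the same value in $\mathcal M$ and $\mathcal M'$, and is optimal in both. Moreover, every seller policy that is optimal in $\mathcal M$ preserves the products as independent processes. -/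

import Mathlib

/-! Single-seller model with platform entry.  Products are indexed by a finite type `ι`. -/

namespace PlatformEntry

/-- The product profiles and the seller's discount factor: innovation cost `c j`, probability
`p j` of being good, reward `rg j` in the good state and `rb j` in the bad state. -/
structure Market (ι : Type*) where
  c : ι → ℝ
  p : ι → ℝ
  rg : ι → ℝ
  rb : ι → ℝ
  γ : ℝ
  c_nonneg : ∀ j, 0 ≤ c j
  p_nonneg : ∀ j, 0 ≤ p j
  p_le_one : ∀ j, p j ≤ 1
  rb_nonneg : ∀ j, 0 ≤ rb j
  rb_lt_rg : ∀ j, rb j < rg j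
  γ_pos : 0 < γ
  γ_lt_one : γ < 1

/-- The three settings for the platform's policy. -/
inductive PlatformPolicy (ι : Type*) where
  | globalEntry (T : ℕ)
  | globalEntryWithFee (T : ℕ) (α : ℝ)
  | heterogeneousEntry (T : ι → ℕ)

/-- Number of timesteps that the platform waits before entering product `j`, once it is good. -/
def PlatformPolicy.entryTime {ι : Type*} : PlatformPolicy ι → ι → ℕ
  | .globalEntry T, _ => T
  | .globalEntryWithFee T _, _ => T
  | .heterogeneousEntry T, j => T j

/-- Transaction fee: the fraction of the reward that the platform keeps. -/
def PlatformPolicy.fee {ι : Type*} : PlatformPolicy ι → ℝ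
  | .globalEntry _ => 0
  | .globalEntryWithFee _ α => α
  | .heterogeneousEntry _ => 0

/-- State of one product together with its counter: `(U, ∅)`, `(B, ∅)`, `(G, C)` with `C`
timesteps left until entry, and `(E, 0)`. -/
inductive ProductState where
  | undeveloped
  | bad
  | good (C : ℕ)
  | entered
  deriving DecidableEq

/-- One timestep of the platform's entry clock. -/
def ProductState.tick : ProductState → ProductState
  | .good C => if 1 < C then .good (C - 1) else .entered
  | s => s

/-- What one sale publicly reveals: `some true` / `some false` if an undeveloped product turns
out good / bad, and `none` if nothing new is revealed. -/
abbrev Signal := Option Bool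

/-- An action: sell nothing (`none`) or sell product `j` (`some j`). -/
abbrev Action (ι : Type*) := Option ι

/-- The past actions and the signals that they produced, oldest first. -/
abbrev History (ι : Type*) := List (Action ι × Signal)

/-- A seller policy: nonanticipating, possibly history dependent and randomized. -/
abbrev SellerPolicy (ι : Type*) := History ι → PMF (Action ι)

/-- The seller's actual problem `original`, in which the entry clock of a good product runs
whether or not the product is sold, and the problem `rested`, in which it runs only when the
product is sold. -/
inductive Problem where
  | original
  | rested

/-- Expected value of `f` under `μ`. -/
noncomputable def expect {Ω : Type*} (μ : PMF Ω) (f : Ω → ℝ) : ℝ :=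
  ∑' ω, (μ ω).toReal * f ω

/-- The coin that shows `true` with probability `p`. -/
noncomputable def coin (p : ℝ) (h0 : 0 ≤ p) (h1 : p ≤ 1) : PMF Bool :=
  PMF.ofFintype (fun b => ENNReal.ofReal (if b then p else 1 - p)) (by
    rw [Fintype.sum_bool, if_pos rfl, if_neg Bool.false_ne_true,
      ← ENNReal.ofReal_add h0 (sub_nonneg.2 h1)]
    simp)

section Model

variable {ι : Type*} [DecidableEq ι] (m : Market ι) (P : PlatformPolicy ι)

/-- Law of the signal when product `j` is sold in state `s`. -/
noncomputable def productSignal (j : ι) : ProductState → PMF Signal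
  | .undeveloped => (coin (m.p j) (m.p_nonneg j) (m.p_le_one j)).map some
  | _ => PMF.pure none

/-- State of product `j` one timestep after it is sold in state `s` with signal `o`.  A product
that is explored and revealed to be good starts its clock at the entry time, and the timestep of
the exploration is the first one on the clock. -/
def sell (j : ι) (s : ProductState) (o : Signal) : ProductState :=
  match s, o with
  | .undeveloped, some true => (ProductState.good (P.entryTime j)).tick
  | .undeveloped, _ => .bad
  | s, _ => s.tick

/-- State one timestep later of a product that is not sold. -/
def unsold : Problem → ProductState → ProductState
  | .original, s => s.tick
  | .rested, s => s

/-- Seller's reward from selling product `j` in state `s` with signal `o`. -/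
noncomputable def productReward (j : ι) (s : ProductState) (o : Signal) : ℝ :=
  match s, o with
  | .undeveloped, some true => -m.c j + (1 - P.fee) * m.rg j
  | .undeveloped, _ => -m.c j + (1 - P.fee) * m.rb j
  | .bad, _ => (1 - P.fee) * m.rb j
  | .good _, _ => (1 - P.fee) * m.rg j
  | .entered, _ => 0

/-- Law of the signal under action `a` in market state `x`. -/
noncomputable def signalLaw (x : ι → ProductState) : Action ι → PMF Signal
  | none => PMF.pure none
  | some j => productSignal m j (x j)

/-- Reward of action `a` in market state `x`, with signal `o`. -/
noncomputable def reward (x : ι → ProductState) (a : Action ι) (o : Signal) : ℝ :=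
  match a with
  | none => 0
  | some j => productReward m P j (x j) o

/-- Market state after action `a` in market state `x`, with signal `o`. -/
def nextState (Q : Problem) (x : ι → ProductState) (a : Action ι) (o : Signal) :
    ι → ProductState :=
  fun j => if a = some j then sell P j (x j) o else unsold Q (x j)

/-- Market state after history `h`; all products are initially undeveloped. -/
def stateAfter (Q : Problem) (h : History ι) : ι → ProductState :=
  h.foldl (fun x e => nextState P Q x e.1 e.2) (fun _ => .undeveloped)

/-- Law of the history of the first `t` timesteps in problem `Q` under policy `π`. -/
noncomputable def historyLaw (Q : Problem) (π : SellerPolicy ι) : ℕ → PMF (History ι)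
  | 0 => PMF.pure []
  | t + 1 => (historyLaw Q π t).bind fun h => (π h).bind fun a =>
      (signalLaw m (stateAfter P Q h) a).map fun o => h ++ [(a, o)]

/-- `h` has positive probability in problem `Q` under policy `π`. -/
def Reachable (Q : Problem) (π : SellerPolicy ι) (h : History ι) : Prop :=
  h ∈ (historyLaw m P Q π h.length).support

/-- Expected reward of timestep `t`. -/
noncomputable def expectedReward (Q : Problem) (π : SellerPolicy ι) (t : ℕ) : ℝ :=
  expect (historyLaw m P Q π t) fun h => expect (π h) fun a =>
    expect (signalLaw m (stateAfter P Q h) a) fun o => reward m P (stateAfter P Q h) a o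

/-- Total expected discounted reward of policy `π` in problem `Q`, all products being initially
undeveloped. -/
noncomputable def value (Q : Problem) (π : SellerPolicy ι) : ℝ :=
  ∑' t : ℕ, m.γ ^ t * expectedReward m P Q π t

/-- `π` maximizes the total expected discounted reward in problem `Q`. -/
def IsOptimal (Q : Problem) (π : SellerPolicy ι) : Prop :=
  ∀ σ : SellerPolicy ι, value m P Q σ ≤ value m P Q π

/-- `π` continues to sell a good product until entry, at every history of positive probability. -/
def KeepsSelling (Q : Problem) (π : SellerPolicy ι) : Prop :=
  ∀ h, Reachable m P Q π h → ∀ j C, stateAfter P Q h j = .good C →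
    ∀ a ∈ (π h).support, a = some j

/-- Under `π` the products of the seller's actual problem evolve as the arms of a rested bandit:
almost surely a product does not change its state while it is not sold. -/
def PreservesIndependence (π : SellerPolicy ι) : Prop :=
  ∀ h, Reachable m P .original π h → ∀ a ∈ (π h).support,
    ∀ o ∈ (signalLaw m (stateAfter P .original h) a).support, ∀ j, a ≠ some j →
      nextState P .original (stateAfter P .original h) a o j = stateAfter P .original h j

/-! The Gittins index of a single product. -/

/-- State of product `j`, started in `s`, after consecutive sales with signals `l`. -/
def productAfter (j : ι) (s : ProductState) (l : List Signal) : ProductState :=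
  l.foldl (sell P j) s

/-- Law of the signals of the first `t` consecutive sales of product `j`, started in `s`. -/
noncomputable def salesLaw (j : ι) (s : ProductState) : ℕ → PMF (List Signal)
  | 0 => PMF.pure []
  | t + 1 => (salesLaw j s t).bind fun l =>
      (productSignal m j (productAfter P j s l)).map fun o => l ++ [o]

/-- A stopping time `τ ≥ 1`, possibly infinite: `τ` is the first `k ≥ 1` at which the signals of
the first `k` sales satisfy the given predicate. -/
abbrev StoppingTime := List Signal → Prop

/-- The event `τ > l.length`, in terms of the signals `l` of the first `l.length` sales. -/
def NotStopped (τ : StoppingTime) (l : List Signal) : Prop :=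
  ∀ k, 1 ≤ k → k ≤ l.length → ¬ τ (l.take k)

open Classical in
/-- Expected discounted reward from selling product `j`, started in `s`, up to `τ`. -/
noncomputable def stoppedReward (j : ι) (s : ProductState) (τ : StoppingTime) : ℝ :=
  ∑' t : ℕ, m.γ ^ t * expect (salesLaw m P j s t) fun l =>
    if NotStopped τ l then
      expect (productSignal m j (productAfter P j s l)) fun o =>
        productReward m P j (productAfter P j s l) o
    else 0

open Classical in
/-- Expected discounted number of timesteps up to `τ`. -/
noncomputable def stoppedTime (j : ι) (s : ProductState) (τ : StoppingTime) : ℝ :=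
  ∑' t : ℕ, m.γ ^ t * expect (salesLaw m P j s t) fun l => if NotStopped τ l then 1 else 0

/-- Gittins index of product `j` in state `s`. -/
noncomputable def gittinsIndex (j : ι) (s : ProductState) : ℝ :=
  ⨆ τ : StoppingTime, stoppedReward m P j s τ / stoppedTime m P j s τ

/-- Gittins index of an action in market state `x`; selling nothing has index `0`. -/
noncomputable def actionIndex (x : ι → ProductState) : Action ι → ℝ
  | none => 0
  | some j => gittinsIndex m P j (x j)

/-- `π` is a Gittins-index policy for problem `Q`: at every history of positive probability it
takes actions of maximal index only (with any tie-breaking). -/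
def IsGittins (Q : Problem) (π : SellerPolicy ι) : Prop :=
  ∀ h, Reachable m P Q π h → ∀ a ∈ (π h).support, ∀ b,
    actionIndex m P (stateAfter P Q h) b ≤ actionIndex m P (stateAfter P Q h) a

end Model

end PlatformEntry

/-! Signals depend on the market only through which products are undeveloped, so a policy has the
same history law in both problems. Along a common history a rested clock has never run further down
than the original one, hence `value_original_le`. The clocks part only when a good product is left
unsold, so a policy that keeps selling has equal values (`value_eq_of_keepsSelling`).

Optimality in the rested problem is Weber's prevailing-charge argument, turned into an explicit
potential. Each sale of a product is charged the smallest index, cut off at zero, that the product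
has shown so far. At this charge exploration breaks even, or cannot gain if the index is negative,
and what a developed product can still earn above the exploration charge is its surplus. The charges
of a product never increase, so their discounted total is largest when they are collected in
decreasing order; slicing this total by levels `y` gives the integral in `potential`. By `slack_eq`
the loss of an action against the potential is a sum of three nonnegative terms: the delay of other
surpluses, the delay of higher charges, and exploration at a negative index. Hence the potential
bounds every value, and an index policy attains it because the invariant `ChargeDominates` makes all
three terms vanish.

Exploring a product never has a larger index than selling it once good. As exploration had maximal
index when it was chosen, selling the good product stays maximal (`GoodDominates`), and strictly so
under the assumption of the last part. Conversely, some index policy keeps selling, so the two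
problems have the same optimal value, and a policy optimal in the original one attains the potential
in the rested one and never incurs a loss. Leaving a good product unsold would then force its
exploration charge up to its good reward, where exploration strictly loses. -/

namespace PlatformEntry

/-! ### Expectations of bounded functions under discrete laws -/

section Expect

variable {Ω Ω' : Type*} (μ : PMF Ω) {f g : Ω → ℝ} {B B' : ℝ}

theorem hasSum_toReal : HasSum (fun ω => (μ ω).toReal) 1 := by
  have h := ENNReal.hasSum_toReal (f := μ) (by simp [PMF.tsum_coe])
  simpa [← ENNReal.tsum_toReal_eq, PMF.tsum_coe, PMF.apply_ne_top] using h

theorem summable_expect (hf : ∀ ω, |f ω| ≤ B) : Summable fun ω => (μ ω).toReal * f ω := by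
  refine Summable.of_norm_bounded ((hasSum_toReal μ).summable.mul_right B) fun ω => ?_
  rw [Real.norm_eq_abs, abs_mul, abs_of_nonneg ENNReal.toReal_nonneg]
  exact mul_le_mul_of_nonneg_left (hf ω) ENNReal.toReal_nonneg

theorem expect_const (c : ℝ) : expect μ (fun _ => c) = c := by
  simp [expect, tsum_mul_right, (hasSum_toReal μ).tsum_eq]

theorem expect_mul_left (c : ℝ) : expect μ (fun ω => c * f ω) = c * expect μ f := by
  simp only [expect, ← tsum_mul_left]
  exact tsum_congr fun ω => by ring

theorem expect_add (hf : ∀ ω, |f ω| ≤ B) (hg : ∀ ω, |g ω| ≤ B') :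
    expect μ (fun ω => f ω + g ω) = expect μ f + expect μ g := by
  simp only [expect, mul_add]
  exact (summable_expect μ hf).tsum_add (summable_expect μ hg)

theorem expect_sub (hf : ∀ ω, |f ω| ≤ B) (hg : ∀ ω, |g ω| ≤ B') :
    expect μ (fun ω => f ω - g ω) = expect μ f - expect μ g := by
  simp only [expect, mul_sub]
  exact (summable_expect μ hf).tsum_sub (summable_expect μ hg)

variable {μ} in
theorem expect_congr (h : ∀ ω ∈ μ.support, f ω = g ω) : expect μ f = expect μ g := by
  refine tsum_congr fun ω => ?_
  by_cases hω : ω ∈ μ.support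
  · rw [h ω hω]
  · simp [(μ.apply_eq_zero_iff ω).2 hω]

variable {μ} in
theorem expect_mono (hf : ∀ ω, |f ω| ≤ B) (hg : ∀ ω, |g ω| ≤ B')
    (h : ∀ ω ∈ μ.support, f ω ≤ g ω) : expect μ f ≤ expect μ g := by
  refine (summable_expect μ hf).tsum_le_tsum (fun ω => ?_) (summable_expect μ hg)
  by_cases hω : ω ∈ μ.support
  · exact mul_le_mul_of_nonneg_left (h ω hω) ENNReal.toReal_nonneg
  · simp [(μ.apply_eq_zero_iff ω).2 hω]

theorem expect_nonneg (h : ∀ ω, 0 ≤ f ω) : 0 ≤ expect μ f :=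
  tsum_nonneg fun ω => mul_nonneg ENNReal.toReal_nonneg (h ω)

theorem abs_expect_le (hf : ∀ ω, |f ω| ≤ B) : |expect μ f| ≤ B := by
  have hB : ∀ ω, |(fun _ : Ω => B) ω| ≤ |B| := fun _ => le_rfl
  have hB' : ∀ ω, |(fun _ : Ω => -B) ω| ≤ |-B| := fun _ => le_rfl
  rw [abs_le]
  constructor
  · simpa only [expect_const] using
      expect_mono (μ := μ) hB' hf fun ω _ => (abs_le.1 (hf ω)).1
  · simpa only [expect_const] using
      expect_mono (μ := μ) hf hB fun ω _ => (abs_le.1 (hf ω)).2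

variable {μ} in
theorem eq_zero_of_expect_eq_zero (hf : ∀ ω, |f ω| ≤ B) (h0 : ∀ ω, 0 ≤ f ω)
    (h : expect μ f = 0) {ω : Ω} (hω : ω ∈ μ.support) : f ω = 0 := by
  have h1 := (hasSum_zero_iff_of_nonneg
    (fun ω => mul_nonneg ENNReal.toReal_nonneg (h0 ω))).1
    ((show ∑' ω, (μ ω).toReal * f ω = 0 from h) ▸ (summable_expect μ hf).hasSum)
  have h2 := congrFun h1 ω
  rcases mul_eq_zero.1 h2 with h3 | h3
  · exact absurd ((ENNReal.toReal_eq_zero_iff _).1 h3)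
      (by simp [PMF.apply_ne_top, (μ.mem_support_iff ω).1 hω])
  · exact h3

theorem expect_pure (ω : Ω) (f : Ω → ℝ) : expect (PMF.pure ω) f = f ω := by
  rw [expect, tsum_eq_single ω]
  · simp
  · intro b hb
    simp [PMF.pure_apply, hb]

/-- The rows of absolute values sum to expectations bounded by `B`, so the double series converges
absolutely. This licenses the exchange of sums in `expect_bind`. -/
theorem summable_expect_bind (k : Ω → PMF Ω') {f : Ω' → ℝ} (hf : ∀ ω, |f ω| ≤ B) :
    Summable fun z : Ω × Ω' => (μ z.1).toReal * ((k z.1 z.2).toReal * f z.2) := by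
  have hrow : ∀ ω, ∑' ω', |(μ ω).toReal * ((k ω ω').toReal * f ω')| =
      (μ ω).toReal * expect (k ω) (fun ω' => |f ω'|) := by
    intro ω
    rw [expect, ← tsum_mul_left]
    refine tsum_congr fun ω' => ?_
    rw [abs_mul, abs_mul, abs_of_nonneg ENNReal.toReal_nonneg,
      abs_of_nonneg ENNReal.toReal_nonneg]
  have habs : ∀ ω, |(|f ω|)| ≤ B := fun ω => by rw [abs_abs]; exact hf ω
  have hsum : Summable fun ω => (μ ω).toReal * expect (k ω) (fun ω' => |f ω'|) :=
    summable_expect μ fun ω => abs_expect_le (k ω) habs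
  refine Summable.of_abs ?_
  refine (summable_prod_of_nonneg (f := fun z : Ω × Ω' =>
    |(μ z.1).toReal * ((k z.1 z.2).toReal * f z.2)|) fun z => abs_nonneg _).2 ⟨fun ω => ?_, ?_⟩
  · exact ((summable_expect (k ω) hf).mul_left (μ ω).toReal).abs
  · exact hsum.congr fun ω => (hrow ω).symm

theorem expect_bind (k : Ω → PMF Ω') {f : Ω' → ℝ} (hf : ∀ ω, |f ω| ≤ B) :
    expect (μ.bind k) f = expect μ fun ω => expect (k ω) f := by
  have h1 : ∀ ω', (μ.bind k ω').toReal * f ω' =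
      ∑' ω, (μ ω).toReal * ((k ω ω').toReal * f ω') := by
    intro ω'
    rw [PMF.bind_apply, ENNReal.tsum_toReal_eq
      fun ω => ENNReal.mul_ne_top (μ.apply_ne_top ω) ((k ω).apply_ne_top ω'), ← tsum_mul_right]
    exact tsum_congr fun ω => by rw [ENNReal.toReal_mul, mul_assoc]
  have h2 : ∀ ω, (μ ω).toReal * expect (k ω) f =
      ∑' ω', (μ ω).toReal * ((k ω ω').toReal * f ω') := fun ω => tsum_mul_left.symm
  rw [expect, tsum_congr h1, expect, tsum_congr h2]
  exact (summable_expect_bind μ k hf).tsum_comm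

theorem expect_map (k : Ω → Ω') {f : Ω' → ℝ} (hf : ∀ ω, |f ω| ≤ B) :
    expect (μ.map k) f = expect μ fun ω => f (k ω) := by
  rw [PMF.map, expect_bind μ _ hf]
  simp only [Function.comp, expect_pure]

end Expect

/-! ### Discounted series -/

theorem summable_discounted {γ : ℝ} (h0 : 0 < γ) (h1 : γ < 1) {X : ℕ → ℝ} {C : ℝ}
    (hX : ∀ t, |X t| ≤ C) : Summable fun t => γ ^ t * X t := by
  refine Summable.of_norm_bounded ((summable_geometric_of_lt_one h0.le h1).mul_right C)
    fun t => ?_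
  rw [Real.norm_eq_abs, abs_mul, abs_of_nonneg (pow_nonneg h0.le t)]
  exact mul_le_mul_of_nonneg_left (hX t) (pow_nonneg h0.le t)

/-- Telescoping of a discounted sum: if `R t + γ A (t + 1) = A t - S t` with `A` bounded. -/
theorem hasSum_discounted {γ : ℝ} (h0 : 0 < γ) (h1 : γ < 1) {R A S : ℕ → ℝ} {B B' : ℝ}
    (hR : ∀ t, |R t| ≤ B) (hA : ∀ t, |A t| ≤ B')
    (h : ∀ t, R t + γ * A (t + 1) = A t - S t) :
    (Summable fun t => γ ^ t * S t) ∧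
      ∑' t, γ ^ t * R t = A 0 - ∑' t, γ ^ t * S t := by
  have hsA := summable_discounted h0 h1 hA
  have hsR := summable_discounted h0 h1 hR
  have hsA' : Summable fun t => γ ^ (t + 1) * A (t + 1) :=
    (summable_nat_add_iff (f := fun t => γ ^ t * A t) 1).2 hsA
  have he : (fun t => γ ^ t * S t) =
      fun t => (γ ^ t * A t - γ ^ (t + 1) * A (t + 1)) - γ ^ t * R t := by
    funext t
    linear_combination (γ ^ t) * h t
  have hd := hsA.sub hsA'
  refine ⟨he ▸ hd.sub hsR, ?_⟩
  rw [he, hd.tsum_sub hsR, hsA.tsum_sub hsA', hsA.tsum_eq_zero_add]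
  simp

/-! ### A single product: signals, clocks and rewards -/

section Product

variable {ι : Type*} (m : Market ι) (P : PlatformPolicy ι)

theorem expect_productSignal_undeveloped (j : ι) (f : Signal → ℝ) :
    expect (productSignal m j .undeveloped) f =
      m.p j * f (some true) + (1 - m.p j) * f (some false) := by
  obtain ⟨B, hB⟩ : ∃ B, ∀ o, |f o| ≤ B := by
    obtain ⟨B, hB⟩ := (Set.finite_range fun o => |f o|).bddAbove
    exact ⟨B, fun o => hB ⟨o, rfl⟩⟩
  rw [productSignal, expect_map _ _ hB, expect, tsum_fintype, Fintype.sum_bool]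
  simp [coin, PMF.ofFintype_apply, ENNReal.toReal_ofReal, m.p_nonneg j,
    sub_nonneg.2 (m.p_le_one j)]

theorem expect_productSignal_developed (j : ι) {s : ProductState} (hs : s ≠ .undeveloped)
    (f : Signal → ℝ) : expect (productSignal m j s) f = f none := by
  cases s <;> first | exact absurd rfl hs | exact expect_pure _ _

theorem sell_developed (j : ι) {s : ProductState} (hs : s ≠ .undeveloped) (o : Signal) :
    sell P j s o = s.tick := by
  cases s <;> first | exact absurd rfl hs | rfl

theorem tick_ne_undeveloped {s : ProductState} (hs : s ≠ .undeveloped) :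
    s.tick ≠ .undeveloped := by
  cases s <;> simp_all [ProductState.tick]
  split <;> simp

theorem sell_ne_undeveloped (j : ι) (s : ProductState) (o : Signal) :
    sell P j s o ≠ .undeveloped := by
  by_cases hs : s = .undeveloped
  · subst hs
    rcases o with _ | _ | _
    · simp [sell]
    · simp [sell]
    · exact tick_ne_undeveloped (s := .good (P.entryTime j)) (by simp)
  · rw [sell_developed P j hs]
    exact tick_ne_undeveloped hs

theorem unsold_of_ne_good (Q : Problem) {s : ProductState} (hs : ∀ C, s ≠ .good C) :
    unsold Q s = s := by
  cases Q
  · cases s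
    case good C => exact absurd rfl (hs C)
    all_goals rfl
  · rfl

theorem tick_good_ne (C : ℕ) : (ProductState.good C).tick ≠ .good C := by
  simp only [ProductState.tick]
  split
  · simp only [ne_eq, ProductState.good.injEq]
    omega
  · simp

theorem productSignal_congr (j : ι) {s s' : ProductState}
    (h : s = .undeveloped ↔ s' = .undeveloped) : productSignal m j s = productSignal m j s' := by
  cases s <;> cases s' <;> simp_all [productSignal]

theorem abs_productReward_le (j : ι) (s : ProductState) (o : Signal) :
    |productReward m P j s o| ≤ |m.c j| + |1 - P.fee| * (|m.rg j| + |m.rb j|) := by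
  have h1 := abs_nonneg (m.c j)
  have h2 := abs_nonneg (m.rg j)
  have h3 := abs_nonneg (m.rb j)
  have h4 := abs_nonneg (1 - P.fee)
  have h5 := mul_nonneg h4 h2
  have h6 := mul_nonneg h4 h3
  have hU : ∀ r, |-m.c j + (1 - P.fee) * r| ≤ |m.c j| + |1 - P.fee| * |r| := fun r =>
    (abs_add_le _ _).trans (by rw [abs_neg, abs_mul])
  have hg := hU (m.rg j)
  have hb := hU (m.rb j)
  unfold productReward
  split
  · linarith
  · linarith
  · rw [abs_mul]
    linarith
  · rw [abs_mul]
    linarith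
  · rw [abs_zero]
    linarith

/-- `s'` is the state `s`, or a good state whose clock is not past that of `s`. -/
def ProductState.Behind (s' s : ProductState) : Prop :=
  s' = s ∨ ∃ C', s' = .good C' ∧ (s = .entered ∨ ∃ C, C ≤ C' ∧ s = .good C)

theorem ProductState.Behind.tick {s' s : ProductState} (h : s'.Behind s) :
    s'.tick.Behind s.tick := by
  rcases h with rfl | ⟨C', rfl, rfl | ⟨C, hC, rfl⟩⟩
  · exact .inl rfl
  · simp only [ProductState.tick]
    split
    · exact .inr ⟨_, rfl, .inl rfl⟩
    · exact .inl rfl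
  · simp only [ProductState.tick]
    split_ifs
    · exact .inr ⟨_, rfl, .inr ⟨_, by omega, rfl⟩⟩
    · exact .inr ⟨_, rfl, .inl rfl⟩
    · omega
    · exact .inl rfl

/-- Covers a timestep without a sale: only the original clock runs, so the lag can only grow. -/
theorem ProductState.Behind.tick_right {s' s : ProductState} (h : s'.Behind s) :
    s'.Behind s.tick := by
  rcases h with rfl | ⟨C', rfl, rfl | ⟨C, hC, rfl⟩⟩
  · cases s'
    case good C =>
      simp only [ProductState.tick]
      split_ifs
      · exact .inr ⟨_, rfl, .inr ⟨_, by omega, rfl⟩⟩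
      · exact .inr ⟨_, rfl, .inl rfl⟩
    all_goals exact .inl rfl
  · exact .inr ⟨_, rfl, .inl rfl⟩
  · simp only [ProductState.tick]
    split_ifs
    · exact .inr ⟨_, rfl, .inr ⟨_, by omega, rfl⟩⟩
    · exact .inr ⟨_, rfl, .inl rfl⟩

theorem ProductState.Behind.eq_of_undeveloped {s' s : ProductState} (h : s'.Behind s) :
    s' = .undeveloped ↔ s = .undeveloped := by
  rcases h with rfl | ⟨C', rfl, rfl | ⟨C, hC, rfl⟩⟩ <;> simp

/-- The good reward does not depend on the clock, so the only real comparison is good against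
entered, where a nonnegative reward meets zero. -/
theorem productReward_mono_of_behind (hfee1 : P.fee ≤ 1) (j : ι) {s' s : ProductState}
    (h : s'.Behind s) (o : Signal) : productReward m P j s o ≤ productReward m P j s' o := by
  rcases h with rfl | ⟨C', rfl, rfl | ⟨C, hC, rfl⟩⟩
  · exact le_rfl
  · exact mul_nonneg (sub_nonneg.2 hfee1) ((m.rb_nonneg j).trans (m.rb_lt_rg j).le)
  · exact le_rfl

theorem exists_reward_bound [Fintype ι] :
    ∃ B, ∀ (x : ι → ProductState) a o, |reward m P x a o| ≤ B := by
  have hn : ∀ j, 0 ≤ |m.c j| + |1 - P.fee| * (|m.rg j| + |m.rb j|) := fun j => by positivity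
  refine ⟨∑ j, (|m.c j| + |1 - P.fee| * (|m.rg j| + |m.rb j|)), fun x a o => ?_⟩
  cases a with
  | none => simpa [reward] using Finset.sum_nonneg fun j _ => hn j
  | some j =>
    exact (abs_productReward_le m P j (x j) o).trans
      (Finset.single_le_sum (f := fun j => |m.c j| + |1 - P.fee| * (|m.rg j| + |m.rb j|))
        (fun j _ => hn j) (Finset.mem_univ j))

end Product

/-! ### Histories and the comparison of the two problems -/

section Histories

variable {ι : Type*} [DecidableEq ι] (m : Market ι) (P : PlatformPolicy ι)

theorem nextState_self (Q : Problem) (x : ι → ProductState) (j : ι) (o : Signal) :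
    nextState P Q x (some j) o j = sell P j (x j) o := by
  simp [nextState]

theorem nextState_of_ne (Q : Problem) (x : ι → ProductState) {a : Action ι} {j : ι}
    (h : a ≠ some j) (o : Signal) : nextState P Q x a o j = unsold Q (x j) := by
  simp [nextState, h]

theorem nextState_rested_of_ne (x : ι → ProductState) {a : Action ι} {j : ι}
    (h : a ≠ some j) (o : Signal) : nextState P .rested x a o j = x j :=
  nextState_of_ne P .rested x h o

theorem stateAfter_nil (Q : Problem) :
    stateAfter P Q ([] : History ι) = fun _ => .undeveloped := rfl

theorem stateAfter_append (Q : Problem) (h : History ι) (a : Action ι) (o : Signal) :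
    stateAfter P Q (h ++ [(a, o)]) = nextState P Q (stateAfter P Q h) a o := by
  simp [stateAfter, List.foldl_append]

/-- Coupling of the two problems on a common history: a sale moves both clocks, any other timestep
at most the original one. -/
theorem behind_stateAfter (h : History ι) (j : ι) :
    (stateAfter P .rested h j).Behind (stateAfter P .original h j) := by
  induction h using List.reverseRecOn with
  | nil => exact .inl rfl
  | append_singleton h e ih =>
    obtain ⟨a, o⟩ := e
    rw [stateAfter_append, stateAfter_append]
    by_cases ha : a = some j
    · subst ha
      rw [nextState_self, nextState_self]
      by_cases hs : stateAfter P .rested h j = .undeveloped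
      · rw [hs, ih.eq_of_undeveloped.1 hs]
        exact .inl rfl
      · rw [sell_developed P j hs, sell_developed P j (mt ih.eq_of_undeveloped.2 hs)]
        exact ih.tick
    · rw [nextState_of_ne P _ _ ha, nextState_of_ne P _ _ ha]
      exact ih.tick_right

theorem signalLaw_original (h : History ι) (a : Action ι) :
    signalLaw m (stateAfter P .original h) a = signalLaw m (stateAfter P .rested h) a := by
  cases a with
  | none => rfl
  | some j => exact productSignal_congr m j (behind_stateAfter P h j).eq_of_undeveloped.symm

theorem historyLaw_original (π : SellerPolicy ι) (t : ℕ) :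
    historyLaw m P .original π t = historyLaw m P .rested π t := by
  induction t with
  | zero => rfl
  | succ t ih => simp only [historyLaw, ih, signalLaw_original]

theorem historyLaw_eq (Q Q' : Problem) (π : SellerPolicy ι) (t : ℕ) :
    historyLaw m P Q π t = historyLaw m P Q' π t := by
  cases Q <;> cases Q' <;> simp [historyLaw_original]

theorem reachable_iff (Q Q' : Problem) (π : SellerPolicy ι) (h : History ι) :
    Reachable m P Q π h ↔ Reachable m P Q' π h := by
  rw [Reachable, Reachable, historyLaw_eq m P Q Q']

theorem length_of_mem_support {Q : Problem} {π : SellerPolicy ι} {t : ℕ} {h : History ι}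
    (hh : h ∈ (historyLaw m P Q π t).support) : h.length = t := by
  induction t generalizing h with
  | zero => simpa [historyLaw] using hh
  | succ t ih =>
    simp only [historyLaw, PMF.mem_support_bind_iff, PMF.support_map] at hh
    obtain ⟨h', hh', a, -, o, -, rfl⟩ := hh
    simp [ih hh']

theorem reachable_of_mem_support {Q : Problem} {π : SellerPolicy ι} {t : ℕ} {h : History ι}
    (hh : h ∈ (historyLaw m P Q π t).support) : Reachable m P Q π h := by
  rwa [Reachable, length_of_mem_support m P hh]

theorem reachable_append_iff (Q : Problem) (π : SellerPolicy ι) (h : History ι) (a : Action ι)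
    (o : Signal) : Reachable m P Q π (h ++ [(a, o)]) ↔
      Reachable m P Q π h ∧ a ∈ (π h).support ∧
        o ∈ (signalLaw m (stateAfter P Q h) a).support := by
  have hl : (h ++ [(a, o)]).length = h.length + 1 := by simp
  rw [Reachable, hl]
  simp only [historyLaw, PMF.mem_support_bind_iff, PMF.support_map]
  constructor
  · rintro ⟨h', hh', a', ha', o', ho', he⟩
    obtain ⟨rfl, he'⟩ := List.append_inj' he rfl
    obtain ⟨rfl, rfl⟩ := Prod.mk.inj (List.singleton_inj.1 he')
    exact ⟨hh', ha', ho'⟩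
  · rintro ⟨hh, ha, ho⟩
    exact ⟨h, hh, a, ha, o, ho, rfl⟩

/-- Induction along the histories of positive probability. -/
theorem Reachable.rec' {Q : Problem} {π : SellerPolicy ι} {I : History ι → Prop} (h0 : I [])
    (hs : ∀ h, Reachable m P Q π h → I h → ∀ a ∈ (π h).support,
      ∀ o ∈ (signalLaw m (stateAfter P Q h) a).support, I (h ++ [(a, o)])) (h : History ι)
    (hh : Reachable m P Q π h) : I h := by
  induction h using List.reverseRecOn with
  | nil => exact h0
  | append_singleton h e ih =>
    obtain ⟨hh', ha, ho⟩ := (reachable_append_iff m P Q π h e.1 e.2).1 hh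
    exact hs h hh' (ih hh') e.1 ha e.2 ho

theorem expect_historyLaw_succ (Q : Problem) (π : SellerPolicy ι) (t : ℕ) {f : History ι → ℝ}
    {B : ℝ} (hf : ∀ h, |f h| ≤ B) :
    expect (historyLaw m P Q π (t + 1)) f = expect (historyLaw m P Q π t) fun h =>
      expect (π h) fun a => expect (signalLaw m (stateAfter P Q h) a) fun o =>
        f (h ++ [(a, o)]) := by
  rw [historyLaw, expect_bind _ _ hf]
  congr 1
  funext h
  rw [expect_bind _ _ hf]
  congr 1
  funext a
  exact expect_map _ _ hf

/-- Expected reward of action `a` in market state `x`. -/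
noncomputable def actionReward (x : ι → ProductState) (a : Action ι) : ℝ :=
  expect (signalLaw m x a) fun o => reward m P x a o

theorem expectedReward_eq (Q : Problem) (π : SellerPolicy ι) (t : ℕ) :
    expectedReward m P Q π t = expect (historyLaw m P Q π t) fun h =>
      expect (π h) fun a => actionReward m P (stateAfter P Q h) a := rfl

theorem abs_expectedReward_le {B : ℝ} (hB : ∀ x a o, |reward m P x a o| ≤ B) (Q : Problem)
    (π : SellerPolicy ι) (t : ℕ) : |expectedReward m P Q π t| ≤ B :=
  abs_expect_le _ fun _ => abs_expect_le _ fun _ => abs_expect_le _ fun _ => hB _ _ _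

theorem value_original_le [Fintype ι] (hfee1 : P.fee ≤ 1) (π : SellerPolicy ι) :
    value m P .original π ≤ value m P .rested π := by
  obtain ⟨B, hB⟩ := exists_reward_bound m P
  have hs : ∀ Q, Summable fun t => m.γ ^ t * expectedReward m P Q π t := fun Q =>
    summable_discounted m.γ_pos m.γ_lt_one (abs_expectedReward_le m P hB Q π)
  refine (hs _).tsum_le_tsum (fun t => ?_) (hs _)
  refine mul_le_mul_of_nonneg_left ?_ (pow_nonneg m.γ_pos.le t)
  rw [expectedReward_eq, expectedReward_eq, historyLaw_original]
  have hr : ∀ x a, |actionReward m P x a| ≤ B := fun x a => abs_expect_le _ fun o => hB x a o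
  refine expect_mono (fun h => abs_expect_le _ fun a => hr _ a)
    (fun h => abs_expect_le _ fun a => hr _ a) fun h _ =>
      expect_mono (fun a => hr _ a) (fun a => hr _ a) fun a _ => ?_
  rw [actionReward, actionReward, signalLaw_original]
  refine expect_mono (fun o => hB _ a o) (fun o => hB _ a o) fun o _ => ?_
  cases a with
  | none => exact le_rfl
  | some j => exact productReward_mono_of_behind m P hfee1 j (behind_stateAfter P h j) o

/-- Only a good product left unsold could separate the states. Since they agree up to the current
timestep, being good means the same in both problems, and it does not matter for which one the
hypothesis is given. -/
theorem stateAfter_eq_of_keepsSelling {Q : Problem} {π : SellerPolicy ι}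
    (hk : KeepsSelling m P Q π) (h : History ι) (hh : Reachable m P Q π h) :
    stateAfter P .original h = stateAfter P .rested h := by
  refine Reachable.rec' m P (I := fun h => stateAfter P .original h = stateAfter P .rested h)
    rfl (fun h hh ih a ha o _ => ?_) h hh
  rw [stateAfter_append, stateAfter_append, ih]
  funext j
  by_cases haj : a = some j
  · subst haj
    rw [nextState_self, nextState_self]
  · rw [nextState_of_ne P _ _ haj, nextState_of_ne P _ _ haj]
    refine unsold_of_ne_good .original fun C hC => haj (hk h hh j C ?_ a ha)
    cases Q
    · rw [ih, hC]
    · exact hC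

theorem value_eq_of_keepsSelling {Q : Problem} {π : SellerPolicy ι}
    (hk : KeepsSelling m P Q π) : value m P .original π = value m P .rested π := by
  refine tsum_congr fun t => ?_
  rw [expectedReward_eq, expectedReward_eq, historyLaw_original]
  congr 1
  refine expect_congr fun h hh => ?_
  rw [stateAfter_eq_of_keepsSelling m P hk h
    ((reachable_iff m P _ _ π h).1 (reachable_of_mem_support m P hh))]

theorem preservesIndependence_iff (π : SellerPolicy ι) :
    PreservesIndependence m P π ↔ KeepsSelling m P .original π := by
  constructor
  · intro hp h hh j C hC a ha
    by_contra haj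
    -- Any possible signal will do: the next state of an unsold product does not depend on it.
    obtain ⟨o, ho⟩ := (signalLaw m (stateAfter P .original h) a).support_nonempty
    have h1 := hp h hh a ha o ho j haj
    rw [nextState_of_ne P _ _ haj, hC] at h1
    exact tick_good_ne C h1
  · intro hk h hh a ha o _ j haj
    rw [nextState_of_ne P _ _ haj]
    exact unsold_of_ne_good .original fun C hC => haj (hk h hh j C hC a ha)

theorem isGittins_rested {Q : Problem} {π : SellerPolicy ι} (hg : IsGittins m P Q π)
    (hk : KeepsSelling m P Q π) : IsGittins m P .rested π := by
  cases Q
  · intro h hh a ha b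
    have hh' := (reachable_iff m P .rested .original π h).1 hh
    rw [← stateAfter_eq_of_keepsSelling m P hk h hh']
    exact hg h hh' a ha b
  · exact hg

end Histories

/-! ### Charges per sale, optimal stopping and the Gittins index -/

section Index

variable {ι : Type*} (m : Market ι) (P : PlatformPolicy ι)

/-- Expected reward of selling product `j` in state `s`. -/
noncomputable def meanReward (j : ι) (s : ProductState) : ℝ :=
  expect (productSignal m j s) fun o => productReward m P j s o

/-- Optimal discounted gain from product `j` in a developed state, when each of its sales is
charged `κ ≥ 0` and the seller may stop at any time. -/
noncomputable def surplus (j : ι) (κ : ℝ) : ProductState → ℝ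
  | .good C => (∑ k ∈ Finset.range (max C 1), m.γ ^ k) * max ((1 - P.fee) * m.rg j - κ) 0
  | .bad => max ((1 - P.fee) * m.rb j - κ) 0 / (1 - m.γ)
  | _ => 0

/-- Discounted gain from exploring product `j` at the charge `κ` per sale. -/
noncomputable def exploreGain (j : ι) (κ : ℝ) : ℝ :=
  meanReward m P j .undeveloped - κ +
    m.γ * expect (productSignal m j .undeveloped) fun o => surplus m P j κ (sell P j .undeveloped o)

/-- Optimal discounted gain from at least one sale of product `j` at the charge `κ`, in the
undeveloped state, and from any number of sales in the other states. -/
noncomputable def gain (j : ι) (κ : ℝ) : ProductState → ℝ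
  | .undeveloped => exploreGain m P j κ
  | s => surplus m P j κ s

variable {m P}

theorem one_sub_γ_pos : 0 < 1 - m.γ := sub_pos.2 m.γ_lt_one

theorem gain_of_ne {s : ProductState} (hs : s ≠ .undeveloped) (j : ι) (κ : ℝ) :
    gain m P j κ s = surplus m P j κ s := by
  cases s <;> first | exact absurd rfl hs | rfl

theorem geom_sum_nonneg' (n : ℕ) : 0 ≤ ∑ k ∈ Finset.range n, m.γ ^ k :=
  Finset.sum_nonneg fun k _ => pow_nonneg m.γ_pos.le k

theorem geom_sum_le (n : ℕ) : ∑ k ∈ Finset.range n, m.γ ^ k ≤ (1 - m.γ)⁻¹ := by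
  rw [← tsum_geometric_of_lt_one m.γ_pos.le m.γ_lt_one]
  exact (summable_geometric_of_lt_one m.γ_pos.le m.γ_lt_one).sum_le_tsum _
    fun k _ => pow_nonneg m.γ_pos.le k

theorem surplus_nonneg (j : ι) (κ : ℝ) (s : ProductState) : 0 ≤ surplus m P j κ s := by
  cases s with
  | good C => exact mul_nonneg (geom_sum_nonneg' _) (le_max_right _ _)
  | bad => exact div_nonneg (le_max_right _ _) one_sub_γ_pos.le
  | undeveloped => exact le_rfl
  | entered => exact le_rfl

theorem exists_surplus_bound (j : ι) (κ : ℝ) : ∃ B, ∀ s, |surplus m P j κ s| ≤ B := by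
  have hg : 0 ≤ (1 - m.γ)⁻¹ * max ((1 - P.fee) * m.rg j - κ) 0 :=
    mul_nonneg (inv_nonneg.2 one_sub_γ_pos.le) (le_max_right _ _)
  have hb : 0 ≤ max ((1 - P.fee) * m.rb j - κ) 0 / (1 - m.γ) :=
    div_nonneg (le_max_right _ _) one_sub_γ_pos.le
  refine ⟨(1 - m.γ)⁻¹ * max ((1 - P.fee) * m.rg j - κ) 0 +
    max ((1 - P.fee) * m.rb j - κ) 0 / (1 - m.γ), fun s => ?_⟩
  rw [abs_of_nonneg (surplus_nonneg j κ s)]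
  cases s with
  | good C =>
    have := mul_le_mul_of_nonneg_right (geom_sum_le (m := m) (max C 1))
      (le_max_right ((1 - P.fee) * m.rg j - κ) 0)
    simp only [surplus]
    linarith
  | bad => simp only [surplus]; linarith
  | undeveloped => simp only [surplus]; linarith
  | entered => simp only [surplus]; linarith

theorem exists_gain_bound (j : ι) (κ : ℝ) : ∃ B, ∀ s, |gain m P j κ s| ≤ B := by
  obtain ⟨B, hB⟩ := exists_surplus_bound (m := m) (P := P) j κ
  refine ⟨max B |exploreGain m P j κ|, fun s => ?_⟩
  by_cases hs : s = .undeveloped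
  · subst hs
    exact le_max_right _ _
  · rw [gain_of_ne hs]
    exact (hB s).trans (le_max_left _ _)

/-- Each sale peels the first term off the geometric sum. A clock at `0` still allows one sale
before entry, just like a clock at `1`; this is why the number of remaining sales is `max C 1`. -/
theorem surplus_tick_good (j : ι) (κ : ℝ) (C : ℕ) :
    max ((1 - P.fee) * m.rg j - κ) 0 + m.γ * surplus m P j κ (ProductState.good C).tick =
      surplus m P j κ (.good C) := by
  simp only [ProductState.tick]
  split_ifs with hC
  · obtain ⟨n, rfl⟩ : ∃ n, C = n + 2 := ⟨C - 2, by omega⟩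
    have h1 : max (n + 2) 1 = n + 1 + 1 := by omega
    have h2 : max (n + 2 - 1) 1 = n + 1 := by omega
    simp only [surplus, h1, h2]
    rw [geom_sum_succ (n := n + 1)]
    ring
  · have h1 : max C 1 = 1 := by omega
    simp [surplus, h1]

theorem meanReward_undeveloped (j : ι) : meanReward m P j .undeveloped =
    -m.c j + (1 - P.fee) * (m.p j * m.rg j + (1 - m.p j) * m.rb j) := by
  rw [meanReward, expect_productSignal_undeveloped]
  simp only [productReward]
  ring

/-- The net reward of a developed product in its current state. -/
noncomputable def netReward (m : Market ι) (P : PlatformPolicy ι) (j : ι) : ProductState → ℝ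
  | .good _ => (1 - P.fee) * m.rg j
  | .bad => (1 - P.fee) * m.rb j
  | _ => 0

theorem meanReward_eq_netReward {s : ProductState} (hs : s ≠ .undeveloped) (j : ι) :
    meanReward m P j s = netReward m P j s := by
  cases s <;> first | exact absurd rfl hs | exact expect_pure _ _

/-- The reward of a developed product is constant until entry, so optimal stopping means selling
while the net reward exceeds `κ`, and each timestep gains the positive part. In the entered state
this needs `0 ≤ κ`. -/
theorem surplus_tick {κ : ℝ} (hκ : 0 ≤ κ) {s : ProductState} (hs : s ≠ .undeveloped) (j : ι) :
    max (netReward m P j s - κ) 0 + m.γ * surplus m P j κ s.tick = surplus m P j κ s := by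
  have := one_sub_γ_pos (m := m)
  cases s with
  | undeveloped => exact absurd rfl hs
  | good C => exact surplus_tick_good j κ C
  | bad =>
    simp only [ProductState.tick, surplus, netReward]
    field_simp
    ring
  | entered => simp [ProductState.tick, surplus, netReward, hκ]

theorem netReward_le_of_surplus_eq_zero {κ : ℝ} (hκ : 0 ≤ κ) {s : ProductState}
    (hs : s ≠ .undeveloped) (j : ι) (h : surplus m P j κ s = 0) : netReward m P j s ≤ κ := by
  have h1 := surplus_tick (m := m) (P := P) hκ hs j
  have h2 := mul_nonneg m.γ_pos.le (surplus_nonneg (m := m) (P := P) j κ s.tick)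
  have h3 := le_max_left (netReward m P j s - κ) 0
  linarith

theorem surplus_eq_zero {κ : ℝ} {s : ProductState} (j : ι) (h : netReward m P j s ≤ κ) :
    surplus m P j κ s = 0 := by
  cases s with
  | undeveloped => rfl
  | good C =>
    have h' : max ((1 - P.fee) * m.rg j - κ) 0 = 0 := max_eq_right (sub_nonpos.2 h)
    simp [surplus, h']
  | bad =>
    have h' : max ((1 - P.fee) * m.rb j - κ) 0 = 0 := max_eq_right (sub_nonpos.2 h)
    simp [surplus, h']
  | entered => rfl

theorem expect_sell_developed {s : ProductState} (hs : s ≠ .undeveloped) (j : ι)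
    (f : ProductState → ℝ) :
    expect (productSignal m j s) (fun o => f (sell P j s o)) = f s.tick := by
  rw [expect_productSignal_developed m j hs, sell_developed P j hs]

theorem gain_sell (j : ι) (κ : ℝ) (s : ProductState) (o : Signal) :
    gain m P j κ (sell P j s o) = surplus m P j κ (sell P j s o) :=
  gain_of_ne (sell_ne_undeveloped P j s o) j κ

/-- Superharmonicity of `gain`, the input to the verification bound `stoppedReward_sub_le`;
`gain_bellman_eq` is the case in which selling is worth the charge. -/
theorem gain_bellman_le {κ : ℝ} (hκ : 0 ≤ κ) (j : ι) (s : ProductState) :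
    meanReward m P j s - κ + m.γ * expect (productSignal m j s)
      (fun o => gain m P j κ (sell P j s o)) ≤ gain m P j κ s := by
  simp only [gain_sell]
  by_cases hs : s = .undeveloped
  · subst hs
    exact le_rfl
  · rw [expect_sell_developed hs, gain_of_ne hs, meanReward_eq_netReward hs,
      ← surplus_tick hκ hs]
    gcongr
    exact le_max_left _ _

theorem gain_bellman_eq {κ : ℝ} (hκ : 0 ≤ κ) (j : ι) (s : ProductState)
    (h : s ≠ .undeveloped → κ ≤ netReward m P j s) :
    meanReward m P j s - κ + m.γ * expect (productSignal m j s)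
      (fun o => gain m P j κ (sell P j s o)) = gain m P j κ s := by
  simp only [gain_sell]
  by_cases hs : s = .undeveloped
  · subst hs
    rfl
  · rw [expect_sell_developed hs, gain_of_ne hs, meanReward_eq_netReward hs,
      ← surplus_tick hκ hs, max_eq_left (sub_nonneg.2 (h hs))]

/-! Stopped sums along consecutive sales. -/

theorem notStopped_nil (τ : StoppingTime) : NotStopped τ [] := by
  intro k h1 h2
  simp at h2
  omega

theorem notStopped_append (τ : StoppingTime) (l : List Signal) (o : Signal) :
    NotStopped τ (l ++ [o]) ↔ NotStopped τ l ∧ ¬ τ (l ++ [o]) := by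
  constructor
  · intro h
    refine ⟨fun k h1 h2 => ?_, ?_⟩
    · have := h k h1 (by simp; omega)
      rwa [List.take_append_of_le_length h2] at this
    · have := h (l.length + 1) (by omega) (by simp)
      rwa [List.take_of_length_le (by simp)] at this
  · rintro ⟨h, h'⟩ k h1 h2
    rw [List.length_append, List.length_singleton] at h2
    rcases Nat.lt_or_ge l.length k with h3 | h3
    · rwa [List.take_of_length_le (by simp; omega)]
    · rw [List.take_append_of_le_length h3]
      exact h k h1 h3

theorem productAfter_append (j : ι) (s : ProductState) (l : List Signal) (o : Signal) :
    productAfter P j s (l ++ [o]) = sell P j (productAfter P j s l) o := by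
  simp [productAfter, List.foldl_append]

open Classical in
/-- `f` at the current state of the product as long as `τ` has not been reached. -/
noncomputable def beforeStop (P : PlatformPolicy ι) (j : ι) (s : ProductState) (τ : StoppingTime)
    (f : ProductState → ℝ) (l : List Signal) : ℝ :=
  if NotStopped τ l then f (productAfter P j s l) else 0

theorem abs_beforeStop_le (j : ι) (s : ProductState) (τ : StoppingTime) {f : ProductState → ℝ}
    {B : ℝ} (hf : ∀ s, |f s| ≤ B) (l : List Signal) : |beforeStop P j s τ f l| ≤ B := by
  rw [beforeStop]
  split_ifs
  · exact hf _
  · rw [abs_zero]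
    exact (abs_nonneg _).trans (hf s)

theorem stoppedReward_eq (j : ι) (s : ProductState) (τ : StoppingTime) :
    stoppedReward m P j s τ = ∑' t : ℕ, m.γ ^ t *
      expect (salesLaw m P j s t) (beforeStop P j s τ (meanReward m P j)) := rfl

theorem stoppedTime_eq (j : ι) (s : ProductState) (τ : StoppingTime) :
    stoppedTime m P j s τ = ∑' t : ℕ, m.γ ^ t *
      expect (salesLaw m P j s t) (beforeStop P j s τ fun _ => 1) := rfl

/-- Expected continuation value of `f` after one more sale. -/
noncomputable def afterSale (m : Market ι) (P : PlatformPolicy ι) (j : ι) (s : ProductState)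
    (τ : StoppingTime) (f : ProductState → ℝ) (l : List Signal) : ℝ :=
  expect (productSignal m j (productAfter P j s l)) fun o => beforeStop P j s τ f (l ++ [o])

theorem expect_salesLaw_succ (j : ι) (s : ProductState) (τ : StoppingTime)
    {f : ProductState → ℝ} {B : ℝ} (hf : ∀ s, |f s| ≤ B) (t : ℕ) :
    expect (salesLaw m P j s (t + 1)) (beforeStop P j s τ f) =
      expect (salesLaw m P j s t) (afterSale m P j s τ f) := by
  rw [salesLaw, expect_bind _ _ (abs_beforeStop_le j s τ hf)]
  congr 1
  funext l
  exact expect_map _ _ (abs_beforeStop_le j s τ hf)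

theorem abs_meanReward_le (j : ι) (s : ProductState) :
    |meanReward m P j s| ≤ |m.c j| + |1 - P.fee| * (|m.rg j| + |m.rb j|) :=
  abs_expect_le _ fun o => abs_productReward_le m P j s o

/-- Loss against the potential `f` in the sale that follows the signals `l`, at the charge `κ`. -/
noncomputable def saleDefect (m : Market ι) (P : PlatformPolicy ι) (j : ι) (s : ProductState)
    (τ : StoppingTime) (κ : ℝ) (f : ProductState → ℝ) (l : List Signal) : ℝ :=
  beforeStop P j s τ f l - (beforeStop P j s τ (meanReward m P j) l -
    κ * beforeStop P j s τ (fun _ => 1) l) - m.γ * afterSale m P j s τ f l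

/-- A Dynkin formula: the discounted values of `f` before `τ` telescope to `f s`, and `saleDefect`
records how far `f` is from harmonic in each sale. A superharmonic `f` yields an upper bound, a
harmonic one an equality. -/
theorem stoppedReward_sub (j : ι) (s : ProductState) (τ : StoppingTime) (κ : ℝ)
    {f : ProductState → ℝ} {B : ℝ} (hf : ∀ s, |f s| ≤ B) :
    stoppedReward m P j s τ - κ * stoppedTime m P j s τ =
      f s - ∑' t, m.γ ^ t * expect (salesLaw m P j s t) (saleDefect m P j s τ κ f) := by
  have hX := abs_beforeStop_le (P := P) j s τ hf
  have hY := abs_beforeStop_le (P := P) j s τ (abs_meanReward_le (m := m) (P := P) j)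
  have hZ := abs_beforeStop_le (P := P) j s τ (f := fun _ => 1) (B := 1) (by simp)
  have hW : ∀ l, |afterSale m P j s τ f l| ≤ B := fun l => abs_expect_le _ fun o => hX _
  have hκZ : ∀ l, |κ * beforeStop P j s τ (fun _ => 1) l| ≤ |κ| * 1 := fun l => by
    rw [abs_mul]
    exact mul_le_mul_of_nonneg_left (hZ l) (abs_nonneg _)
  have hγW : ∀ l, |m.γ * afterSale m P j s τ f l| ≤ |m.γ| * B := fun l => by
    rw [abs_mul]
    exact mul_le_mul_of_nonneg_left (hW l) (abs_nonneg _)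
  have hYZ := fun l => (abs_sub _ _).trans (add_le_add (hY l) (hκZ l))
  have hXYZ := fun l => (abs_sub _ _).trans (add_le_add (hX l) (hYZ l))
  have hsY := summable_discounted m.γ_pos m.γ_lt_one fun t =>
    abs_expect_le (salesLaw m P j s t) hY
  have hsZ := summable_discounted m.γ_pos m.γ_lt_one fun t =>
    abs_expect_le (salesLaw m P j s t) hZ
  have key := (hasSum_discounted m.γ_pos m.γ_lt_one
    (R := fun t => expect (salesLaw m P j s t) fun l =>
      beforeStop P j s τ (meanReward m P j) l - κ * beforeStop P j s τ (fun _ => 1) l)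
    (A := fun t => expect (salesLaw m P j s t) (beforeStop P j s τ f))
    (S := fun t => expect (salesLaw m P j s t) (saleDefect m P j s τ κ f))
    (fun t => abs_expect_le _ hYZ) (fun t => abs_expect_le _ hX) (fun t => ?_)).2
  · have h0 : expect (salesLaw m P j s 0) (beforeStop P j s τ f) = f s := by
      rw [salesLaw, expect_pure, beforeStop, if_pos (notStopped_nil τ)]
      rfl
    rw [h0] at key
    rw [← key, stoppedReward_eq, stoppedTime_eq, ← tsum_mul_left,
      ← hsY.tsum_sub (hsZ.mul_left κ)]
    refine tsum_congr fun t => ?_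
    rw [expect_sub _ hY hκZ, expect_mul_left]
    ring
  · change _ = _ - expect _ fun l => _ - _ - _
    rw [expect_sub _ hXYZ hγW, expect_sub _ hX hYZ, expect_mul_left,
      expect_salesLaw_succ j s τ hf]
    ring

theorem stoppedTime_bounds (j : ι) (s : ProductState) (τ : StoppingTime) :
    1 ≤ stoppedTime m P j s τ ∧ stoppedTime m P j s τ ≤ (1 - m.γ)⁻¹ := by
  have hZ := abs_beforeStop_le (P := P) j s τ (f := fun _ => 1) (B := 1) (by simp)
  have hs := summable_discounted m.γ_pos m.γ_lt_one fun t =>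
    abs_expect_le (salesLaw m P j s t) hZ
  have h0 : ∀ t, 0 ≤ expect (salesLaw m P j s t) (beforeStop P j s τ fun _ => 1) := fun t =>
    expect_nonneg _ fun l => by rw [beforeStop]; split_ifs <;> simp
  rw [stoppedTime_eq]
  constructor
  · have h1 := hs.sum_le_tsum {0} fun t _ => mul_nonneg (pow_nonneg m.γ_pos.le t) (h0 t)
    rwa [Finset.sum_singleton, salesLaw, expect_pure, beforeStop, if_pos (notStopped_nil τ),
      pow_zero, one_mul] at h1
  · rw [← tsum_geometric_of_lt_one m.γ_pos.le m.γ_lt_one]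
    refine hs.tsum_le_tsum (fun t => ?_) (summable_geometric_of_lt_one m.γ_pos.le m.γ_lt_one)
    exact mul_le_of_le_one_right (pow_nonneg m.γ_pos.le t)
      ((le_abs_self _).trans (abs_expect_le _ hZ))

theorem stoppedReward_sub_le {κ : ℝ} (hκ : 0 ≤ κ) (j : ι) (s : ProductState)
    (τ : StoppingTime) :
    stoppedReward m P j s τ - κ * stoppedTime m P j s τ ≤ gain m P j κ s := by
  obtain ⟨B, hB⟩ := exists_gain_bound (m := m) (P := P) j κ
  rw [stoppedReward_sub j s τ κ hB]
  refine sub_le_self _ (tsum_nonneg fun t => mul_nonneg (pow_nonneg m.γ_pos.le t)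
    (expect_nonneg _ fun l => ?_))
  rw [saleDefect]
  by_cases hl : NotStopped τ l
  · have h1 : afterSale m P j s τ (gain m P j κ) l ≤
        expect (productSignal m j (productAfter P j s l))
          fun o => gain m P j κ (sell P j (productAfter P j s l) o) := by
      refine expect_mono (fun o => abs_beforeStop_le j s τ hB _) (fun o => hB _) fun o _ => ?_
      rw [beforeStop, productAfter_append]
      split_ifs
      · exact le_rfl
      -- Stopping forfeits the gain in the state after a sale. That state is developed, so the gain
      -- is a surplus and cannot be negative, unlike the gain from exploring.
      · rw [gain_sell]
        exact surplus_nonneg _ _ _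
    have h2 := gain_bellman_le (m := m) (P := P) hκ j (productAfter P j s l)
    have h3 := mul_le_mul_of_nonneg_left h1 m.γ_pos.le
    simp only [beforeStop, if_pos hl]
    linarith
  · have h1 : afterSale m P j s τ (gain m P j κ) l = 0 := by
      rw [afterSale, ← expect_const (productSignal m j (productAfter P j s l)) 0]
      congr 1
      funext o
      rw [beforeStop, if_neg fun h => hl ((notStopped_append τ l o).1 h).1]
    simp [beforeStop, hl, h1]

theorem exists_stoppedReward_sub_eq {κ : ℝ} (hκ : 0 ≤ κ) (j : ι) (s : ProductState)
    (hs : s ≠ .undeveloped → κ ≤ netReward m P j s) :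
    ∃ τ, stoppedReward m P j s τ - κ * stoppedTime m P j s τ = gain m P j κ s := by
  obtain ⟨B, hB⟩ := exists_gain_bound (m := m) (P := P) j κ
  -- The optimal rule stops as soon as nothing is left above the charge, so stopping forfeits
  -- nothing.
  let τ : StoppingTime := fun l => surplus m P j κ (productAfter P j s l) = 0
  refine ⟨τ, ?_⟩
  rw [stoppedReward_sub j s τ κ hB]
  have h0 : ∀ l, saleDefect m P j s τ κ (gain m P j κ) l = 0 := by
    intro l
    rw [saleDefect]
    by_cases hl : NotStopped τ l
    · have h1 : afterSale m P j s τ (gain m P j κ) l =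
          expect (productSignal m j (productAfter P j s l))
            fun o => gain m P j κ (sell P j (productAfter P j s l) o) := by
        rw [afterSale]
        congr 1
        funext o
        rw [beforeStop, productAfter_append]
        split_ifs with ho
        · rfl
        · have h2 : τ (l ++ [o]) := by
            by_contra h2
            exact ho ((notStopped_append τ l o).2 ⟨hl, h2⟩)
          rw [gain_sell, ← productAfter_append]
          exact h2.symm
      have h2 : productAfter P j s l ≠ .undeveloped →
          κ ≤ netReward m P j (productAfter P j s l) := by
        -- The first sale is compulsory, so `τ` says nothing about the initial state and `hs` is
        -- needed there. Later, not having stopped means a nonzero surplus.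
        rcases List.eq_nil_or_concat l with rfl | ⟨l', o, rfl⟩
        · exact hs
        · intro _
          by_contra! h3
          exact hl _ (by simp) le_rfl (by
            rw [List.take_length]
            exact surplus_eq_zero j h3.le)
      have h3 := gain_bellman_eq (m := m) (P := P) hκ j (productAfter P j s l) h2
      simp only [beforeStop, if_pos hl, h1]
      linarith
    · have h1 : afterSale m P j s τ (gain m P j κ) l = 0 := by
        rw [afterSale, ← expect_const (productSignal m j (productAfter P j s l)) 0]
        congr 1
        funext o
        rw [beforeStop, if_neg fun h => hl ((notStopped_append τ l o).1 h).1]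
      simp [beforeStop, hl, h1]
  have h1 : ∀ t, expect (salesLaw m P j s t) (saleDefect m P j s τ κ (gain m P j κ)) = 0 :=
    fun t => by rw [show saleDefect m P j s τ κ (gain m P j κ) = fun _ => 0 from funext h0,
      expect_const]
  simp [h1]

/-! The Gittins index against a given charge. -/

/-- The stopped reward is at most `κ T + gain` with `T` between `1` and `(1 - γ)⁻¹`, so `gain / T`
is at most `gain` or `(1 - γ) * gain`, according to the sign of the gain. The bound is uniform in
`τ`, so strictness survives the supremum in `gittinsIndex_lt_of_gain_neg`. -/
theorem gittinsIndex_le {κ : ℝ} (hκ : 0 ≤ κ) (j : ι) (s : ProductState) :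
    gittinsIndex m P j s ≤ κ + max (gain m P j κ s) ((1 - m.γ) * gain m P j κ s) := by
  refine ciSup_le fun τ => ?_
  obtain ⟨h1, h2⟩ := stoppedTime_bounds (m := m) (P := P) j s τ
  have h3 := stoppedReward_sub_le (m := m) (P := P) hκ j s τ
  rw [div_le_iff₀ (by linarith)]
  set g := gain m P j κ s
  set T := stoppedTime m P j s τ
  suffices h : g ≤ max g ((1 - m.γ) * g) * T by linarith
  have hγ := one_sub_γ_pos (m := m)
  rcases le_total 0 g with hg | hg
  · calc g ≤ g * T := le_mul_of_one_le_right hg h1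
      _ ≤ _ := mul_le_mul_of_nonneg_right (le_max_left _ _) (by linarith)
  · have h4 : (1 - m.γ) * T ≤ 1 := by
      have := mul_le_mul_of_nonneg_left h2 hγ.le
      rwa [mul_inv_cancel₀ hγ.ne'] at this
    calc g ≤ ((1 - m.γ) * T) * g := by nlinarith
      _ = ((1 - m.γ) * g) * T := by ring
      _ ≤ _ := mul_le_mul_of_nonneg_right (le_max_right _ _) (by linarith)

theorem gittinsIndex_le_of_gain_nonpos {κ : ℝ} (hκ : 0 ≤ κ) {j : ι} {s : ProductState}
    (h : gain m P j κ s ≤ 0) : gittinsIndex m P j s ≤ κ := by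
  have h1 := gittinsIndex_le (m := m) (P := P) hκ j s
  have h2 : max (gain m P j κ s) ((1 - m.γ) * gain m P j κ s) ≤ 0 :=
    max_le h (mul_nonpos_of_nonneg_of_nonpos one_sub_γ_pos.le h)
  linarith

theorem gittinsIndex_lt_of_gain_neg {κ : ℝ} (hκ : 0 ≤ κ) {j : ι} {s : ProductState}
    (h : gain m P j κ s < 0) : gittinsIndex m P j s < κ := by
  have h1 := gittinsIndex_le (m := m) (P := P) hκ j s
  have h2 : max (gain m P j κ s) ((1 - m.γ) * gain m P j κ s) < 0 :=
    max_lt h (mul_neg_of_pos_of_neg one_sub_γ_pos h)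
  linarith

theorem bddAbove_stopped (j : ι) (s : ProductState) :
    BddAbove (Set.range fun τ => stoppedReward m P j s τ / stoppedTime m P j s τ) := by
  refine ⟨max (gain m P j 0 s) 0, ?_⟩
  rintro _ ⟨τ, rfl⟩
  obtain ⟨h1, h2⟩ := stoppedTime_bounds (m := m) (P := P) j s τ
  have h3 := stoppedReward_sub_le (m := m) (P := P) le_rfl j s τ
  rw [div_le_iff₀ (by linarith)]
  have h4 := le_mul_of_one_le_right (le_max_right (gain m P j 0 s) 0) h1
  have h5 := le_max_left (gain m P j 0 s) 0
  linarith

theorem le_gittinsIndex {κ : ℝ} (hκ : 0 ≤ κ) {j : ι} {s : ProductState}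
    (hs : s ≠ .undeveloped → κ ≤ netReward m P j s) (h : 0 ≤ gain m P j κ s) :
    κ ≤ gittinsIndex m P j s := by
  obtain ⟨τ, hτ⟩ := exists_stoppedReward_sub_eq hκ j s hs
  refine le_ciSup_of_le (bddAbove_stopped j s) τ ?_
  rw [le_div_iff₀ (by linarith [(stoppedTime_bounds (m := m) (P := P) j s τ).1])]
  linarith

theorem netReward_nonneg (hfee1 : P.fee ≤ 1) (j : ι) (s : ProductState) :
    0 ≤ netReward m P j s := by
  have h := sub_nonneg.2 hfee1
  cases s with
  | good C => exact mul_nonneg h ((m.rb_nonneg j).trans (m.rb_lt_rg j).le)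
  | bad => exact mul_nonneg h (m.rb_nonneg j)
  | undeveloped => exact le_rfl
  | entered => exact le_rfl

/-- At a charge equal to the net reward, selling just breaks even, and both comparisons of the index
with a charge apply. -/
theorem gittinsIndex_developed (hfee1 : P.fee ≤ 1) {s : ProductState} (hs : s ≠ .undeveloped)
    (j : ι) : gittinsIndex m P j s = netReward m P j s := by
  have h : gain m P j (netReward m P j s) s = 0 := by
    rw [gain_of_ne hs]
    exact surplus_eq_zero j le_rfl
  exact le_antisymm (gittinsIndex_le_of_gain_nonpos (netReward_nonneg hfee1 j s) h.le)
    (le_gittinsIndex (netReward_nonneg hfee1 j s) (fun _ => le_rfl) h.ge)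

theorem continuous_surplus (j : ι) (s : ProductState) :
    Continuous fun κ => surplus m P j κ s := by
  cases s <;> simp only [surplus] <;> fun_prop

theorem continuous_exploreGain (j : ι) : Continuous (exploreGain m P j) := by
  have h : exploreGain m P j = fun κ => meanReward m P j .undeveloped - κ +
      m.γ * (m.p j * surplus m P j κ (sell P j .undeveloped (some true)) +
        (1 - m.p j) * surplus m P j κ (sell P j .undeveloped (some false))) := by
    funext κ
    rw [exploreGain, expect_productSignal_undeveloped]
  have h1 := continuous_surplus (m := m) (P := P) j (sell P j .undeveloped (some true))
  have h2 := continuous_surplus (m := m) (P := P) j (sell P j .undeveloped (some false))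
  rw [h]
  fun_prop

/-- The index of the undeveloped product `j`, or `0` if it is negative. -/
noncomputable def exploreCharge (m : Market ι) (P : PlatformPolicy ι) (j : ι) : ℝ :=
  max (gittinsIndex m P j .undeveloped) 0

theorem exploreCharge_nonneg (j : ι) : 0 ≤ exploreCharge m P j := le_max_right _ _

/-- If the gain were positive, by continuity it would stay positive at a slightly larger charge, and
the index would be at least that charge. -/
theorem exploreGain_exploreCharge_nonpos (j : ι) :
    exploreGain m P j (exploreCharge m P j) ≤ 0 := by
  by_contra! h
  have h1 : ∀ᶠ κ in nhdsWithin (exploreCharge m P j) (Set.Ioi (exploreCharge m P j)),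
      0 < exploreGain m P j κ :=
    nhdsWithin_le_nhds (((continuous_exploreGain j).tendsto _).eventually (lt_mem_nhds h))
  obtain ⟨κ, hκ, hκ'⟩ := (h1.and self_mem_nhdsWithin).exists
  have h2 : exploreCharge m P j < κ := hκ'
  have h3 : κ ≤ gittinsIndex m P j .undeveloped :=
    le_gittinsIndex ((exploreCharge_nonneg j).trans h2.le) (fun h => absurd rfl h) hκ.le
  exact absurd (h3.trans (le_max_left _ 0)) (not_le.2 h2)

theorem exploreGain_exploreCharge_eq_zero {j : ι} (h : 0 ≤ gittinsIndex m P j .undeveloped) :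
    exploreGain m P j (exploreCharge m P j) = 0 := by
  refine le_antisymm (exploreGain_exploreCharge_nonpos j) ?_
  rw [exploreCharge, max_eq_left h]
  by_contra! h1
  exact lt_irrefl _ (gittinsIndex_lt_of_gain_neg h (s := .undeveloped) h1)

theorem netReward_bad_le (hfee1 : P.fee ≤ 1) (j : ι) (C : ℕ) :
    netReward m P j .bad ≤ netReward m P j (.good C) :=
  mul_le_mul_of_nonneg_left (m.rb_lt_rg j).le (sub_nonneg.2 hfee1)

/-- No developed state leaves a surplus at this charge, so only the exploration itself counts: it
loses the innovation cost and, for a bad product, the difference of the rewards. The loss is strict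
exactly when the cost is positive or both `p j < 1` and the fee is below `1`, which is the
assumption of the last part of the theorem. -/
theorem exploreGain_netReward_good (hfee1 : P.fee ≤ 1) (j : ι) :
    exploreGain m P j ((1 - P.fee) * m.rg j) =
      -(m.c j + (1 - m.p j) * ((1 - P.fee) * (m.rg j - m.rb j))) := by
  have h1 : ∀ o, surplus m P j ((1 - P.fee) * m.rg j) (sell P j .undeveloped o) = 0 := by
    intro o
    refine surplus_eq_zero j ?_
    cases sell P j .undeveloped o with
    | good C => exact le_rfl
    | bad => exact netReward_bad_le hfee1 j 0
    | undeveloped => exact netReward_nonneg (m := m) hfee1 j (.good 0)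
    | entered => exact netReward_nonneg (m := m) hfee1 j (.good 0)
  simp only [exploreGain, h1, expect_const, meanReward_undeveloped]
  ring

theorem gittinsIndex_undeveloped_le (hfee1 : P.fee ≤ 1) (j : ι) :
    gittinsIndex m P j .undeveloped ≤ (1 - P.fee) * m.rg j := by
  refine gittinsIndex_le_of_gain_nonpos (netReward_nonneg hfee1 j (.good 0)) ?_
  change exploreGain m P j ((1 - P.fee) * m.rg j) ≤ 0
  rw [exploreGain_netReward_good hfee1, neg_nonpos]
  exact add_nonneg (m.c_nonneg j) (mul_nonneg (sub_nonneg.2 (m.p_le_one j))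
    (mul_nonneg (sub_nonneg.2 hfee1) (sub_nonneg.2 (m.rb_lt_rg j).le)))

theorem exploreCharge_le (hfee1 : P.fee ≤ 1) (j : ι) :
    exploreCharge m P j ≤ (1 - P.fee) * m.rg j :=
  max_le (gittinsIndex_undeveloped_le hfee1 j) (netReward_nonneg (m := m) hfee1 j (.good 0))

theorem exploreGain_netReward_good_neg (hfee1 : P.fee ≤ 1) {j : ι}
    (hj : 0 < m.c j ∨ (m.p j < 1 ∧ P.fee < 1)) :
    exploreGain m P j ((1 - P.fee) * m.rg j) < 0 := by
  rw [exploreGain_netReward_good hfee1, neg_neg_iff_pos]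
  rcases hj with hc | ⟨hp, hf⟩
  · exact add_pos_of_pos_of_nonneg hc (mul_nonneg (sub_nonneg.2 (m.p_le_one j))
      (mul_nonneg (sub_nonneg.2 hfee1) (sub_nonneg.2 (m.rb_lt_rg j).le)))
  · exact add_pos_of_nonneg_of_pos (m.c_nonneg j) (mul_pos (sub_pos.2 hp)
      (mul_pos (sub_pos.2 hf) (sub_pos.2 (m.rb_lt_rg j))))

theorem gittinsIndex_undeveloped_lt (hfee1 : P.fee ≤ 1) {j : ι}
    (hj : 0 < m.c j ∨ (m.p j < 1 ∧ P.fee < 1)) :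
    gittinsIndex m P j .undeveloped < (1 - P.fee) * m.rg j :=
  gittinsIndex_lt_of_gain_neg (netReward_nonneg hfee1 j (.good 0))
    (exploreGain_netReward_good_neg hfee1 hj)

end Index

open MeasureTheory

/-! ### Prevailing charges and their level sets -/

section Charge

variable {ι : Type*} (m : Market ι) (P : PlatformPolicy ι)

/-- Charge for selling product `j` in state `s`, when `κ` is the charge for exploring it. -/
noncomputable def charge (j : ι) (κ : ℝ) : ProductState → ℝ
  | .bad => min κ ((1 - P.fee) * m.rb j)
  | .entered => 0
  | _ => κ

/-- Expected value of `γ ^ n`, where `n` is the (possibly infinite) number of sales of product `j`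
from state `s` on whose charge exceeds `y`. -/
noncomputable def drain (j : ι) (κ y : ℝ) : ProductState → ℝ
  | .undeveloped => if y < κ then m.γ * (m.p j * m.γ ^ (P.entryTime j - 1) +
      (1 - m.p j) * if y < min κ ((1 - P.fee) * m.rb j) then 0 else 1) else 1
  | .good C => if y < κ then m.γ ^ max C 1 else 1
  | .bad => if y < min κ ((1 - P.fee) * m.rb j) then 0 else 1
  | .entered => 1

variable {m P}

theorem drain_nonneg (j : ι) (κ y : ℝ) (s : ProductState) : 0 ≤ drain m P j κ y s := by
  have h1 := m.p_nonneg j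
  have h2 := sub_nonneg.2 (m.p_le_one j)
  have h3 := m.γ_pos
  cases s <;> simp only [drain] <;> (try split_ifs) <;> positivity

theorem drain_le_one (j : ι) (κ y : ℝ) (s : ProductState) : drain m P j κ y s ≤ 1 := by
  have h1 := m.p_nonneg j
  have h2 := sub_nonneg.2 (m.p_le_one j)
  have h3 : ∀ n, m.γ ^ n ≤ 1 := fun n => pow_le_one₀ m.γ_pos.le m.γ_lt_one.le
  have h4 : ∀ u : ℝ, u ≤ 1 →
      m.γ * (m.p j * m.γ ^ (P.entryTime j - 1) + (1 - m.p j) * u) ≤ 1 := fun u hu => by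
    have h5 := mul_le_mul_of_nonneg_left (h3 (P.entryTime j - 1)) h1
    have h6 := mul_le_mul_of_nonneg_left hu h2
    have h7 : m.p j * m.γ ^ (P.entryTime j - 1) + (1 - m.p j) * u ≤ 1 := by linarith
    exact (mul_le_mul_of_nonneg_left h7 m.γ_pos.le).trans (by linarith [m.γ_lt_one])
  cases s with
  | undeveloped =>
    simp only [drain]
    split_ifs
    · exact h4 0 zero_le_one
    · exact h4 1 le_rfl
    · exact le_rfl
  | good C =>
    simp only [drain]
    split_ifs
    · exact h3 _
    · exact le_rfl
  | bad => simp only [drain]; split_ifs <;> simp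
  | entered => exact le_rfl

theorem measurable_drain (j : ι) (κ : ℝ) (s : ProductState) :
    Measurable fun y => drain m P j κ y s := by
  have h : ∀ c : ℝ, MeasurableSet {y | y < c} := fun c => measurableSet_Iio
  cases s with
  | undeveloped =>
    exact Measurable.ite (h _) (measurable_const.mul (measurable_const.add
      (measurable_const.mul (Measurable.ite (h _) measurable_const measurable_const))))
      measurable_const
  | good C => exact Measurable.ite (h _) measurable_const measurable_const
  | bad => exact Measurable.ite (h _) measurable_const measurable_const
  | entered => exact measurable_const

theorem drain_tick_good {κ y : ℝ} (hy : y < κ) (j : ι) (C : ℕ) :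
    drain m P j κ y (ProductState.good C).tick = m.γ ^ (max C 1 - 1) := by
  simp only [ProductState.tick]
  split_ifs with hC
  · have h1 : max (C - 1) 1 = max C 1 - 1 := by omega
    simp [drain, hy, h1]
  · have h1 : max C 1 - 1 = 0 := by omega
    simp [drain, h1]

/-- A sale above the level `y` uses up one factor `γ`. The exploration counts as the first of the
`P.entryTime j` sales of a good product, hence the exponent `P.entryTime j - 1` after it; a bad
product above the level is sold forever, hence its value `0`. -/
theorem drain_of_lt {κ y : ℝ} (hy0 : 0 ≤ y) {j : ι} (hT : 1 ≤ P.entryTime j) {s : ProductState}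
    (hy : y < charge m P j κ s) :
    m.γ * expect (productSignal m j s) (fun o => drain m P j κ y (sell P j s o)) =
      drain m P j κ y s := by
  cases s with
  | undeveloped =>
    have hy' : y < κ := hy
    have h1 : max (P.entryTime j) 1 = P.entryTime j := max_eq_left hT
    rw [expect_productSignal_undeveloped]
    simp only [sell, drain_tick_good hy', h1]
    simp [drain, hy']
  | good C =>
    have hy' : y < κ := hy
    rw [expect_sell_developed (by simp), drain_tick_good hy', ← pow_succ']
    have h1 : max C 1 - 1 + 1 = max C 1 := by omega
    simp [drain, hy', h1]
  | bad =>
    have hy' : y < min κ ((1 - P.fee) * m.rb j) := hy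
    rw [expect_sell_developed (by simp)]
    simp only [ProductState.tick, drain, if_pos hy', mul_zero]
  | entered => exact absurd hy (not_lt.2 hy0)

theorem drain_of_le {κ y : ℝ} {j : ι} {s : ProductState} (hy : charge m P j κ s ≤ y) :
    drain m P j κ y s = 1 := by
  cases s with
  | undeveloped => exact if_neg (not_lt.2 hy)
  | good C => exact if_neg (not_lt.2 hy)
  | bad => exact if_neg (not_lt.2 hy)
  | entered => rfl

theorem charge_tick_le {κ : ℝ} (hκ : 0 ≤ κ) (j : ι) (s : ProductState) :
    charge m P j κ s.tick ≤ charge m P j κ s := by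
  cases s with
  | good C => simp only [ProductState.tick]; split_ifs <;> simp [charge, hκ]
  | undeveloped => exact le_rfl
  | bad => exact le_rfl
  | entered => exact le_rfl

/-- This monotonicity is what makes the level sets useful: a product whose charge is at or below `y`
never rises above `y` again. -/
theorem charge_sell_le {κ : ℝ} (hκ : 0 ≤ κ) (j : ι) (s : ProductState) (o : Signal) :
    charge m P j κ (sell P j s o) ≤ charge m P j κ s := by
  by_cases hs : s = .undeveloped
  · subst hs
    rcases o with _ | _ | _
    · exact min_le_left _ _
    · exact min_le_left _ _
    · exact charge_tick_le hκ j (.good _)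
  · rw [sell_developed P j hs]
    exact charge_tick_le hκ j s

theorem charge_le {κ : ℝ} (hκ : 0 ≤ κ) (j : ι) (s : ProductState) :
    charge m P j κ s ≤ κ := by
  cases s with
  | good C => exact le_rfl
  | undeveloped => exact le_rfl
  | bad => exact min_le_left _ _
  | entered => exact hκ

theorem charge_nonneg (hfee1 : P.fee ≤ 1) {κ : ℝ} (hκ : 0 ≤ κ) (j : ι) (s : ProductState) :
    0 ≤ charge m P j κ s := by
  cases s with
  | good C => exact hκ
  | undeveloped => exact hκ
  | bad => exact le_min hκ (netReward_nonneg (m := m) hfee1 j .bad)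
  | entered => exact le_rfl

/-- In a developed state the charge is the minimum of `κ` and the net reward, so what remains is the
positive part in `surplus_tick`. Only exploration breaks the balance. -/
theorem meanReward_sub_charge {κ : ℝ} (hκ : 0 ≤ κ) {j : ι} (hκ' : κ ≤ (1 - P.fee) * m.rg j)
    (s : ProductState) :
    meanReward m P j s - charge m P j κ s + m.γ * expect (productSignal m j s)
      (fun o => surplus m P j κ (sell P j s o)) =
        surplus m P j κ s + if s = .undeveloped then exploreGain m P j κ else 0 := by
  by_cases hs : s = .undeveloped
  · subst hs
    simp [surplus, charge, exploreGain]
  · rw [if_neg hs, add_zero, expect_sell_developed hs, meanReward_eq_netReward hs,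
      ← surplus_tick hκ hs]
    congr 1
    cases s with
    | undeveloped => exact absurd rfl hs
    | good C => simp [netReward, charge, hκ']
    | bad =>
      simp only [netReward, charge]
      rcases le_total κ ((1 - P.fee) * m.rb j) with h | h
      · rw [min_eq_left h, max_eq_left (sub_nonneg.2 h)]
      · rw [min_eq_right h, max_eq_right (sub_nonpos.2 h), sub_self]
    | entered => simp [netReward, charge, hκ]

end Charge

/-! ### The potential and the loss of an action in the rested problem -/

section Potential

variable {ι : Type*} [Fintype ι] [DecidableEq ι] (m : Market ι) (P : PlatformPolicy ι)

/-- `1 - E γ ^ n`, where `n` is the number of sales from market state `x` on whose charge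
exceeds `y`. -/
noncomputable def backlog (x : ι → ProductState) (y : ℝ) : ℝ :=
  1 - ∏ j, drain m P j (exploreCharge m P j) y (x j)

/-- Value of market state `x` in the rested problem, for the states that a Gittins-index policy
reaches, and an upper bound of the value in general. -/
noncomputable def potential (x : ι → ProductState) : ℝ :=
  ∑ j, surplus m P j (exploreCharge m P j) (x j) +
    (∫ y in Set.Ioc 0 (∑ j, exploreCharge m P j), backlog m P x y) / (1 - m.γ)

/-- Charge for action `a` in market state `x`. -/
noncomputable def actionCharge (x : ι → ProductState) : Action ι → ℝ
  | none => 0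
  | some j => charge m P j (exploreCharge m P j) (x j)

/-- Loss from exploring a product whose index is negative. -/
noncomputable def exploreLoss (x : ι → ProductState) : Action ι → ℝ
  | none => 0
  | some j => if x j = .undeveloped then -exploreGain m P j (exploreCharge m P j) else 0

/-- Loss of action `a` in market state `x` of the rested problem, against the potential. -/
noncomputable def slack (x : ι → ProductState) (a : Action ι) : ℝ :=
  potential m P x - actionReward m P x a -
    m.γ * expect (signalLaw m x a) fun o => potential m P (nextState P .rested x a o)

variable {m P}

omit [DecidableEq ι] in
theorem backlog_mem (x : ι → ProductState) (y : ℝ) :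
    0 ≤ backlog m P x y ∧ backlog m P x y ≤ 1 := by
  have h1 : 0 ≤ ∏ j, drain m P j (exploreCharge m P j) y (x j) :=
    Finset.prod_nonneg fun j _ => drain_nonneg _ _ _ _
  have h2 : ∏ j, drain m P j (exploreCharge m P j) y (x j) ≤ 1 :=
    Finset.prod_le_one (fun j _ => drain_nonneg _ _ _ _) fun j _ => drain_le_one _ _ _ _
  rw [backlog]
  constructor <;> linarith

omit [DecidableEq ι] in
theorem measurable_backlog (x : ι → ProductState) : Measurable (backlog m P x) :=
  measurable_const.sub (Finset.measurable_fun_prod _ fun j _ => measurable_drain j _ _)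

theorem integrable_of_mem_Icc {f : ℝ → ℝ} (hf : Measurable f) (h : ∀ y, 0 ≤ f y ∧ f y ≤ 1)
    (K : ℝ) : IntegrableOn f (Set.Ioc 0 K) := by
  refine Measure.integrableOn_of_bounded (M := 1) (by simp) hf.aestronglyMeasurable
    (Filter.Eventually.of_forall fun y => ?_)
  rw [Real.norm_eq_abs, abs_of_nonneg (h y).1]
  exact (h y).2

/-- Layer-cake formula, by which a charge is split into levels. -/
theorem integral_lt_eq {c K : ℝ} (h0 : 0 ≤ c) (hK : c ≤ K) :
    ∫ y in Set.Ioc 0 K, (if y < c then (1 : ℝ) else 0) = c := by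
  have h1 : (fun y : ℝ => if y < c then (1 : ℝ) else 0) = (Set.Iio c).indicator fun _ => 1 := by
    funext y
    simp [Set.indicator_apply]
  have h2 : Set.Ioc 0 K ∩ Set.Iio c = Set.Ioo 0 c := by
    ext y
    simp only [Set.mem_inter_iff, Set.mem_Ioc, Set.mem_Iio, Set.mem_Ioo]
    constructor
    · rintro ⟨⟨h3, -⟩, h4⟩
      exact ⟨h3, h4⟩
    · rintro ⟨h3, h4⟩
      exact ⟨⟨h3, h4.le.trans hK⟩, h4⟩
  rw [h1, setIntegral_indicator measurableSet_Iio, h2]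
  simp [h0]

theorem expect_signal_integral (μ : PMF Signal) {f : Signal → ℝ → ℝ} {s : Set ℝ}
    (hf : ∀ o, IntegrableOn (f o) s) :
    expect μ (fun o => ∫ y in s, f o y) = ∫ y in s, expect μ fun o => f o y := by
  simp only [expect, tsum_fintype]
  rw [integral_finsetSum _ fun o _ => (hf o).const_mul _]
  exact Finset.sum_congr rfl fun o _ => (integral_const_mul _ _).symm

theorem integrableOn_expect_signal (μ : PMF Signal) {f : Signal → ℝ → ℝ} {s : Set ℝ}
    (hf : ∀ o, IntegrableOn (f o) s) : IntegrableOn (fun y => expect μ fun o => f o y) s := by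
  simp only [expect, tsum_fintype]
  exact integrable_finsetSum _ fun o _ => (hf o).const_mul _

theorem exists_signal_bound (f : Signal → ℝ) : ∃ B, ∀ o, |f o| ≤ B := by
  obtain ⟨B, hB⟩ := (Set.finite_range fun o => |f o|).bddAbove
  exact ⟨B, fun o => hB ⟨o, rfl⟩⟩

theorem expect_add_signal (μ : PMF Signal) (f g : Signal → ℝ) :
    expect μ (fun o => f o + g o) = expect μ f + expect μ g := by
  obtain ⟨B, hB⟩ := exists_signal_bound f
  obtain ⟨B', hB'⟩ := exists_signal_bound g
  exact expect_add μ hB hB'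

theorem sum_eq_add_others (f : ι → ℝ) (j : ι) :
    ∑ i, f i = f j + ∑ i, if some j = some i then 0 else f i := by
  have h : ∀ i, f i = (if j = i then f i else 0) + if some j = some i then 0 else f i := by
    intro i
    by_cases hi : j = i <;> simp [hi]
  rw [Finset.sum_congr rfl fun i _ => h i, Finset.sum_add_distrib, Finset.sum_ite_eq]
  simp

omit [Fintype ι] in
theorem nextState_none (x : ι → ProductState) (o : Signal) :
    nextState P .rested x none o = x := by
  funext j
  exact nextState_rested_of_ne P x (by simp) o

/-- The sold product balances by `meanReward_sub_charge`; every other surplus is frozen for one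
timestep, and the delay costs the fraction `1 - γ` of it. -/
theorem sum_surplus_bellman (hfee1 : P.fee ≤ 1) (x : ι → ProductState) (a : Action ι) :
    actionReward m P x a - actionCharge m P x a + m.γ * expect (signalLaw m x a)
      (fun o => ∑ i, surplus m P i (exploreCharge m P i) (nextState P .rested x a o i)) =
    ∑ i, surplus m P i (exploreCharge m P i) (x i) - exploreLoss m P x a -
      (1 - m.γ) * ∑ i, if a = some i then 0 else surplus m P i (exploreCharge m P i) (x i) := by
  cases a with
  | none =>
    simp only [nextState_none, expect_const, actionReward, reward, actionCharge, exploreLoss]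
    simp only [reduceCtorEq, if_false]
    ring
  | some j =>
    have h1 : ∀ o, ∑ i, surplus m P i (exploreCharge m P i) (nextState P .rested x (some j) o i) =
        surplus m P j (exploreCharge m P j) (sell P j (x j) o) +
          ∑ i, if some j = some i then 0 else surplus m P i (exploreCharge m P i) (x i) := by
      intro o
      rw [sum_eq_add_others _ j, nextState_self]
      congr 1
      refine Finset.sum_congr rfl fun i _ => ?_
      split_ifs with hi
      · rfl
      · rw [nextState_rested_of_ne P x hi]
    have h2 := meanReward_sub_charge (m := m) (P := P) (exploreCharge_nonneg j)
      (exploreCharge_le hfee1 j) (x j)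
    rw [expect_congr fun o _ => h1 o, expect_add_signal, expect_const,
      sum_eq_add_others (fun i => surplus m P i (exploreCharge m P i) (x i)) j]
    change meanReward m P j (x j) - charge m P j (exploreCharge m P j) (x j) +
      m.γ * (expect (productSignal m j (x j)) _ + _) = _
    have h3 : exploreLoss m P x (some j) =
        -(if x j = .undeveloped then exploreGain m P j (exploreCharge m P j) else 0) := by
      simp only [exploreLoss]
      split_ifs <;> simp
    rw [h3]
    linear_combination h2

/-- At a fixed level, a sale charged above `y` works off the backlog without loss. Any other action
leaves the backlog as it is and pays for the delay. -/
theorem backlog_bellman (hT : ∀ j, 1 ≤ P.entryTime j) (x : ι → ProductState) (a : Action ι)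
    {y : ℝ} (hy0 : 0 ≤ y) :
    (1 - m.γ) * (if y < actionCharge m P x a then 1 else 0) + m.γ * expect (signalLaw m x a)
      (fun o => backlog m P (nextState P .rested x a o) y) =
    backlog m P x y - (1 - m.γ) * (if actionCharge m P x a ≤ y then backlog m P x y else 0) := by
  cases a with
  | none =>
    have h1 : actionCharge m P x none ≤ y := hy0
    simp only [nextState_none, expect_const, if_neg (not_lt.2 h1), if_pos h1]
    ring
  | some j =>
    set R := ∏ i ∈ Finset.univ.erase j, drain m P i (exploreCharge m P i) y (x i) with hR
    have hx : backlog m P x y = 1 - R * drain m P j (exploreCharge m P j) y (x j) := by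
      rw [backlog, ← Finset.mul_prod_erase _ _ (Finset.mem_univ j), mul_comm]
    have hn : ∀ o, backlog m P (nextState P .rested x (some j) o) y =
        1 + (-R) * drain m P j (exploreCharge m P j) y (sell P j (x j) o) := by
      intro o
      rw [backlog, ← Finset.mul_prod_erase _ _ (Finset.mem_univ j), nextState_self,
        Finset.prod_congr rfl fun i hi => by
          rw [nextState_rested_of_ne P x (a := some j) (j := i)
            (by simpa using (Finset.ne_of_mem_erase hi).symm)]]
      ring
    rw [expect_congr fun o _ => hn o, expect_add_signal, expect_const, expect_mul_left]
    change _ * (if y < charge m P j (exploreCharge m P j) (x j) then 1 else 0) +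
      _ * (1 + -R * expect (productSignal m j (x j)) _) =
        _ - _ * (if charge m P j (exploreCharge m P j) (x j) ≤ y then _ else 0)
    by_cases hy : y < charge m P j (exploreCharge m P j) (x j)
    · have h1 := drain_of_lt hy0 (hT j) hy
      rw [if_pos hy, if_neg (not_le.2 hy), hx, ← h1]
      ring
    · have h1 := drain_of_le (not_lt.1 hy)
      have h2 : ∀ o, drain m P j (exploreCharge m P j) y (sell P j (x j) o) = 1 := fun o =>
        drain_of_le ((charge_sell_le (exploreCharge_nonneg j) j _ o).trans (not_lt.1 hy))
      rw [if_neg hy, if_pos (not_lt.1 hy), expect_congr fun o _ => h2 o, expect_const, hx, h1]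
      ring

omit [DecidableEq ι] in
theorem actionCharge_mem (hfee1 : P.fee ≤ 1) (x : ι → ProductState) (a : Action ι) :
    0 ≤ actionCharge m P x a ∧ actionCharge m P x a ≤ ∑ j, exploreCharge m P j := by
  cases a with
  | none => exact ⟨le_rfl, Finset.sum_nonneg fun j _ => exploreCharge_nonneg j⟩
  | some j =>
    exact ⟨charge_nonneg hfee1 (exploreCharge_nonneg j) j _,
      (charge_le (exploreCharge_nonneg j) j _).trans
        (Finset.single_le_sum (f := exploreCharge m P) (fun i _ => exploreCharge_nonneg i)
          (Finset.mem_univ j))⟩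

/-- Adds the surplus balance to the backlog balance integrated over the levels. Charging for a sale
and crediting the charge back cancel, because the sum of the exploration charges bounds every charge
and the layers recover it in full. -/
theorem slack_eq (hT : ∀ j, 1 ≤ P.entryTime j) (hfee1 : P.fee ≤ 1) (x : ι → ProductState)
    (a : Action ι) :
    slack m P x a =
      (1 - m.γ) * (∑ i, if a = some i then 0 else surplus m P i (exploreCharge m P i) (x i)) +
      (∫ y in Set.Ioc 0 (∑ j, exploreCharge m P j),
        if actionCharge m P x a ≤ y then backlog m P x y else 0) + exploreLoss m P x a := by
  set K := ∑ j, exploreCharge m P j with hK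
  obtain ⟨hc0, hcK⟩ := actionCharge_mem (m := m) hfee1 x a
  have hγ := one_sub_γ_pos (m := m)
  have hb : ∀ x, IntegrableOn (backlog m P x) (Set.Ioc 0 K) := fun x =>
    integrable_of_mem_Icc (measurable_backlog x) (backlog_mem x) K
  have hl : IntegrableOn (fun y => if y < actionCharge m P x a then (1 : ℝ) else 0)
      (Set.Ioc 0 K) :=
    integrable_of_mem_Icc (Measurable.ite measurableSet_Iio measurable_const measurable_const)
      (fun y => by split_ifs <;> simp) K
  have hi : IntegrableOn (fun y => if actionCharge m P x a ≤ y then backlog m P x y else 0)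
      (Set.Ioc 0 K) :=
    integrable_of_mem_Icc
      (Measurable.ite measurableSet_Ici (measurable_backlog x) measurable_const)
      (fun y => by
        split_ifs
        · exact backlog_mem x y
        · simp) K
  have he := integrableOn_expect_signal (signalLaw m x a)
    (f := fun o y => backlog m P (nextState P .rested x a o) y) (s := Set.Ioc 0 K)
    fun o => hb _
  have h1 : (1 - m.γ) * actionCharge m P x a + m.γ * expect (signalLaw m x a)
      (fun o => ∫ y in Set.Ioc 0 K, backlog m P (nextState P .rested x a o) y) =
      (∫ y in Set.Ioc 0 K, backlog m P x y) - (1 - m.γ) * ∫ y in Set.Ioc 0 K,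
        if actionCharge m P x a ≤ y then backlog m P x y else 0 := by
    rw [expect_signal_integral _ fun o => hb _]
    -- The charge becomes the integral of its level indicators, so that the identity can be checked
    -- level by level.
    nth_rewrite 1 [← integral_lt_eq hc0 hcK]
    rw [← integral_const_mul, ← integral_const_mul, ← integral_const_mul,
      ← integral_add (hl.const_mul _) (he.const_mul _), ← integral_sub (hb x) (hi.const_mul _)]
    exact setIntegral_congr_fun measurableSet_Ioc fun y hy =>
      backlog_bellman hT x a hy.1.le
  have h2 := sum_surplus_bellman (m := m) hfee1 x a
  have h3 : expect (signalLaw m x a) (fun o => potential m P (nextState P .rested x a o)) =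
      expect (signalLaw m x a)
        (fun o => ∑ i, surplus m P i (exploreCharge m P i) (nextState P .rested x a o i)) +
      (1 - m.γ)⁻¹ * expect (signalLaw m x a)
        (fun o => ∫ y in Set.Ioc 0 K, backlog m P (nextState P .rested x a o) y) := by
    rw [← expect_mul_left, ← expect_add_signal]
    refine expect_congr fun o _ => ?_
    rw [potential, div_eq_inv_mul]
  rw [slack, h3, potential, ← hK]
  field_simp
  linear_combination -(1 - m.γ) * h2 - h1

omit [Fintype ι] [DecidableEq ι] in
theorem exploreLoss_nonneg (x : ι → ProductState) (a : Action ι) :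
    0 ≤ exploreLoss m P x a := by
  cases a with
  | none => exact le_rfl
  | some j =>
    simp only [exploreLoss]
    split_ifs
    · exact neg_nonneg.2 (exploreGain_exploreCharge_nonpos j)
    · exact le_rfl

omit [Fintype ι] in
theorem otherSurplus_nonneg (x : ι → ProductState) (a : Action ι) (i : ι) :
    0 ≤ if a = some i then 0 else surplus m P i (exploreCharge m P i) (x i) := by
  split_ifs
  · exact le_rfl
  · exact surplus_nonneg _ _ _

omit [DecidableEq ι] in
theorem integral_backlog_nonneg (x : ι → ProductState) (a : Action ι) :
    0 ≤ ∫ y in Set.Ioc 0 (∑ j, exploreCharge m P j),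
      if actionCharge m P x a ≤ y then backlog m P x y else 0 :=
  integral_nonneg fun y => by
    change 0 ≤ if actionCharge m P x a ≤ y then backlog m P x y else 0
    split_ifs
    · exact (backlog_mem x y).1
    · exact le_rfl

theorem slack_nonneg (hT : ∀ j, 1 ≤ P.entryTime j) (hfee1 : P.fee ≤ 1) (x : ι → ProductState)
    (a : Action ι) : 0 ≤ slack m P x a := by
  rw [slack_eq hT hfee1]
  exact add_nonneg (add_nonneg (mul_nonneg one_sub_γ_pos.le
    (Finset.sum_nonneg fun i _ => otherSurplus_nonneg x a i)) (integral_backlog_nonneg x a))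
    (exploreLoss_nonneg x a)

theorem of_slack_eq_zero (hT : ∀ j, 1 ≤ P.entryTime j) (hfee1 : P.fee ≤ 1)
    {x : ι → ProductState} {a : Action ι} (h : slack m P x a = 0) :
    (∀ i, a ≠ some i → surplus m P i (exploreCharge m P i) (x i) = 0) ∧
      exploreLoss m P x a = 0 := by
  have h1 := Finset.sum_nonneg fun i (_ : i ∈ Finset.univ) =>
    otherSurplus_nonneg (m := m) (P := P) x a i
  have h2 := integral_backlog_nonneg (m := m) (P := P) x a
  have h3 := exploreLoss_nonneg (m := m) (P := P) x a
  have h4 := mul_nonneg (one_sub_γ_pos (m := m)).le h1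
  rw [slack_eq hT hfee1] at h
  refine ⟨fun i hi => ?_, by linarith⟩
  have h5 : ∑ i, (if a = some i then 0 else surplus m P i (exploreCharge m P i) (x i)) = 0 :=
    (mul_eq_zero.1 (by linarith : (1 - m.γ) * _ = 0)).resolve_left
      (one_sub_γ_pos (m := m)).ne'
  have h6 := (Finset.sum_eq_zero_iff_of_nonneg fun i _ => otherSurplus_nonneg x a i).1 h5 i
    (Finset.mem_univ i)
  rwa [if_neg hi] at h6

omit [DecidableEq ι] in
theorem exists_potential_bound : ∃ B, ∀ x, |potential m P x| ≤ B := by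
  choose B hB using fun j => exists_surplus_bound (m := m) (P := P) j (exploreCharge m P j)
  have hK : 0 ≤ ∑ j, exploreCharge m P j := Finset.sum_nonneg fun j _ => exploreCharge_nonneg j
  refine ⟨∑ j, B j + (∑ j, exploreCharge m P j) / (1 - m.γ), fun x => ?_⟩
  refine (abs_add_le _ _).trans (add_le_add ((Finset.abs_sum_le_sum_abs _ _).trans
    (Finset.sum_le_sum fun j _ => hB j _)) ?_)
  rw [abs_div, abs_of_pos (one_sub_γ_pos (m := m))]
  refine div_le_div_of_nonneg_right ?_ one_sub_γ_pos.le
  have h := norm_setIntegral_le_of_norm_le_const (μ := volume) (f := backlog m P x) (C := 1)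
    (s := Set.Ioc 0 (∑ j, exploreCharge m P j)) (by simp) fun y _ => by
      rw [Real.norm_eq_abs, abs_of_nonneg (backlog_mem x y).1]
      exact (backlog_mem x y).2
  simpa [hK] using h

/-- Expected loss in timestep `t`. -/
noncomputable def expectedSlack (m : Market ι) (P : PlatformPolicy ι) (π : SellerPolicy ι)
    (t : ℕ) : ℝ :=
  expect (historyLaw m P .rested π t) fun h => expect (π h) fun a =>
    slack m P (stateAfter P .rested h) a

theorem exists_slack_bound : ∃ B, ∀ x a, |slack m P x a| ≤ B := by
  obtain ⟨B, hB⟩ := exists_potential_bound (m := m) (P := P)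
  obtain ⟨B', hB'⟩ := exists_reward_bound m P
  refine ⟨B + B' + |m.γ| * B, fun x a => ?_⟩
  refine (abs_sub _ _).trans (add_le_add ((abs_sub _ _).trans (add_le_add (hB x) ?_)) ?_)
  · exact abs_expect_le _ fun o => hB' x a o
  · rw [abs_mul]
    exact mul_le_mul_of_nonneg_left (abs_expect_le _ fun o => hB _) (abs_nonneg _)

/-- By the definition of `slack`, the discounted expected potential telescopes; the shortfall of a
policy is its discounted expected loss. -/
theorem value_rested_eq (π : SellerPolicy ι) :
    (Summable fun t => m.γ ^ t * expectedSlack m P π t) ∧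
    value m P .rested π =
      potential m P (fun _ => .undeveloped) - ∑' t, m.γ ^ t * expectedSlack m P π t := by
  obtain ⟨B, hB⟩ := exists_potential_bound (m := m) (P := P)
  obtain ⟨B', hB'⟩ := exists_reward_bound m P
  have key := hasSum_discounted m.γ_pos m.γ_lt_one
    (R := expectedReward m P .rested π)
    (A := fun t => expect (historyLaw m P .rested π t) fun h =>
      potential m P (stateAfter P .rested h))
    (S := expectedSlack m P π)
    (abs_expectedReward_le m P hB' .rested π) (fun t => abs_expect_le _ fun h => hB _)
    fun t => ?_
  · refine ⟨key.1, key.2.trans ?_⟩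
    rw [historyLaw, expect_pure, stateAfter_nil]
  · have hr : ∀ x a, |actionReward m P x a| ≤ B' := fun x a => abs_expect_le _ fun o => hB' x a o
    have hn : ∀ x a, |m.γ * expect (signalLaw m x a) fun o =>
        potential m P (nextState P .rested x a o)| ≤ |m.γ| * B := fun x a => by
      rw [abs_mul]
      exact mul_le_mul_of_nonneg_left (abs_expect_le _ fun o => hB _) (abs_nonneg _)
    have hp : ∀ x a, |potential m P x - actionReward m P x a| ≤ B + B' := fun x a =>
      (abs_sub _ _).trans (add_le_add (hB x) (hr x a))
    have h1 : ∀ h, expect (π h) (fun a => slack m P (stateAfter P .rested h) a) =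
        potential m P (stateAfter P .rested h) -
          expect (π h) (fun a => actionReward m P (stateAfter P .rested h) a) -
          m.γ * expect (π h) fun a => expect (signalLaw m (stateAfter P .rested h) a) fun o =>
            potential m P (stateAfter P .rested (h ++ [(a, o)])) := by
      intro h
      simp only [slack, stateAfter_append]
      rw [expect_sub _ (hp _) (hn _), expect_sub _ (fun _ => hB _) (hr _), expect_const,
        expect_mul_left]
    have hr' : ∀ h, |expect (π h) fun a => actionReward m P (stateAfter P .rested h) a| ≤ B' :=
      fun h => abs_expect_le _ fun a => hr _ a
    have hn' : ∀ h, |m.γ * expect (π h) fun a =>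
        expect (signalLaw m (stateAfter P .rested h) a) fun o =>
          potential m P (stateAfter P .rested (h ++ [(a, o)]))| ≤ |m.γ| * B := fun h => by
      rw [abs_mul]
      exact mul_le_mul_of_nonneg_left
        (abs_expect_le _ fun a => abs_expect_le _ fun o => hB _) (abs_nonneg _)
    have hp' := fun h => (abs_sub (potential m P (stateAfter P .rested h))
      (expect (π h) fun a => actionReward m P (stateAfter P .rested h) a)).trans
        (add_le_add (hB _) (hr' h))
    rw [expect_historyLaw_succ m P _ _ _ fun h => hB _, expectedSlack,
      expect_congr fun h _ => h1 h, expect_sub _ hp' hn', expect_sub _ (fun h => hB _) hr',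
      expect_mul_left, expectedReward_eq]
    ring

theorem expectedSlack_nonneg (hT : ∀ j, 1 ≤ P.entryTime j) (hfee1 : P.fee ≤ 1)
    (π : SellerPolicy ι) (t : ℕ) : 0 ≤ expectedSlack m P π t :=
  expect_nonneg _ fun _ => expect_nonneg _ fun _ => slack_nonneg hT hfee1 _ _

theorem value_rested_le (hT : ∀ j, 1 ≤ P.entryTime j) (hfee1 : P.fee ≤ 1)
    (π : SellerPolicy ι) : value m P .rested π ≤ potential m P fun _ => .undeveloped := by
  rw [(value_rested_eq π).2]
  exact sub_le_self _ (tsum_nonneg fun t =>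
    mul_nonneg (pow_nonneg m.γ_pos.le t) (expectedSlack_nonneg hT hfee1 π t))

theorem value_rested_eq_potential {π : SellerPolicy ι}
    (h : ∀ h, Reachable m P .rested π h → ∀ a ∈ (π h).support,
      slack m P (stateAfter P .rested h) a = 0) :
    value m P .rested π = potential m P fun _ => .undeveloped := by
  have h1 : ∀ t, expectedSlack m P π t = 0 := by
    intro t
    rw [expectedSlack, ← expect_const (historyLaw m P .rested π t) 0]
    refine expect_congr fun g hg => ?_
    rw [← expect_const (π g) 0]
    exact expect_congr fun a ha => h g (reachable_of_mem_support m P hg) a ha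
  simp [(value_rested_eq π).2, h1]

/-- The total loss is a vanishing sum of nonnegative terms, and every reachable history and every
action in the support has positive weight. -/
theorem slack_eq_zero_of_value_eq (hT : ∀ j, 1 ≤ P.entryTime j) (hfee1 : P.fee ≤ 1)
    {π : SellerPolicy ι} (hv : value m P .rested π = potential m P fun _ => .undeveloped)
    {h : History ι} (hh : Reachable m P .rested π h) {a : Action ι} (ha : a ∈ (π h).support) :
    slack m P (stateAfter P .rested h) a = 0 := by
  obtain ⟨hs, he⟩ := value_rested_eq (m := m) (P := P) π
  obtain ⟨B, hB⟩ := exists_slack_bound (m := m) (P := P)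
  have h0 : ∑' t, m.γ ^ t * expectedSlack m P π t = 0 := by linarith
  have h1 := (hasSum_zero_iff_of_nonneg fun t =>
    mul_nonneg (pow_nonneg m.γ_pos.le t) (expectedSlack_nonneg hT hfee1 π t)).1
      (h0 ▸ hs.hasSum)
  have h2 : expectedSlack m P π h.length = 0 :=
    (mul_eq_zero.1 (congrFun h1 h.length)).resolve_left (pow_pos m.γ_pos _).ne'
  have h3 := eq_zero_of_expect_eq_zero (fun g => abs_expect_le _ fun a => hB _ a)
    (fun g => expect_nonneg _ fun a => slack_nonneg hT hfee1 _ a) h2 hh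
  exact eq_zero_of_expect_eq_zero (fun a => hB _ a) (fun a => slack_nonneg hT hfee1 _ a) h3 ha

end Potential

/-! ### Gittins-index policies and optimal policies -/

section Policies

variable {ι : Type*} [Fintype ι] [DecidableEq ι] {m : Market ι} {P : PlatformPolicy ι}

omit [Fintype ι] [DecidableEq ι] in
theorem charge_le_max_gittinsIndex (hfee1 : P.fee ≤ 1) (j : ι) (s : ProductState) :
    charge m P j (exploreCharge m P j) s ≤ max (gittinsIndex m P j s) 0 := by
  cases s with
  | undeveloped => exact le_rfl
  | good C =>
    rw [gittinsIndex_developed hfee1 (by simp)]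
    exact (exploreCharge_le hfee1 j).trans (le_max_left _ _)
  | bad =>
    rw [gittinsIndex_developed hfee1 (by simp)]
    exact (min_le_right _ _).trans (le_max_left _ _)
  | entered => exact le_max_right _ _

omit [Fintype ι] [DecidableEq ι] in
theorem min_netReward_le_charge (j : ι) (κ : ℝ) {s : ProductState} (hs : s ≠ .undeveloped) :
    min κ (netReward m P j s) ≤ charge m P j κ s := by
  cases s with
  | undeveloped => exact absurd rfl hs
  | good C => exact min_le_left _ _
  | bad => exact le_rfl
  | entered => exact min_le_right _ _

omit [Fintype ι] [DecidableEq ι] in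
theorem ne_undeveloped_of_surplus_ne_zero {j : ι} {κ : ℝ} {s : ProductState}
    (h : surplus m P j κ s ≠ 0) : s ≠ .undeveloped := by
  rintro rfl
  exact h rfl

/-- While a product is worth more than its exploration charge, no other action has an index above
that charge. -/
def ChargeDominates (m : Market ι) (P : PlatformPolicy ι) (x : ι → ProductState) : Prop :=
  ∀ j, surplus m P j (exploreCharge m P j) (x j) ≠ 0 →
    ∀ b, b ≠ some j → actionIndex m P x b ≤ exploreCharge m P j

omit [Fintype ι] [DecidableEq ι] in
theorem ChargeDominates.eq_of_surplus_ne_zero (hfee1 : P.fee ≤ 1) {x : ι → ProductState}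
    (hx : ChargeDominates m P x) {a : Action ι}
    (ha : ∀ b, actionIndex m P x b ≤ actionIndex m P x a) {i : ι}
    (hi : surplus m P i (exploreCharge m P i) (x i) ≠ 0) : a = some i := by
  by_contra hai
  have h1 := hx i hi a hai
  have h2 := ha (some i)
  refine hi (surplus_eq_zero i ?_)
  rw [← gittinsIndex_developed hfee1 (ne_undeveloped_of_surplus_ne_zero hi)]
  exact h2.trans h1

omit [Fintype ι] [DecidableEq ι] in
-- A maximal index also means a maximal charge. The two could differ only if the index of the sold
-- product exceeds its charge; then that product has a surplus, and the invariant holds all other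
-- indices down to its exploration charge.
theorem ChargeDominates.charge_le_actionCharge (hfee1 : P.fee ≤ 1) {x : ι → ProductState}
    (hx : ChargeDominates m P x) {a : Action ι}
    (ha : ∀ b, actionIndex m P x b ≤ actionIndex m P x a) (i : ι) :
    charge m P i (exploreCharge m P i) (x i) ≤ actionCharge m P x a := by
  have h0 : 0 ≤ actionIndex m P x a := ha none
  have h1 : charge m P i (exploreCharge m P i) (x i) ≤ actionIndex m P x a :=
    (charge_le_max_gittinsIndex hfee1 i (x i)).trans (max_le (ha (some i)) h0)
  cases a with
  | none => exact h1
  | some j =>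
    change _ ≤ charge m P j (exploreCharge m P j) (x j)
    by_cases hU : x j = .undeveloped
    · refine h1.trans ?_
      change gittinsIndex m P j (x j) ≤ _
      rw [hU]
      exact le_max_left _ _
    · have h2 : actionIndex m P x (some j) = netReward m P j (x j) :=
        gittinsIndex_developed hfee1 hU j
      by_cases hij : i = j
      · rw [hij]
      · refine (le_min ?_ (h2 ▸ h1)).trans (min_netReward_le_charge j _ hU)
        by_cases hs : surplus m P j (exploreCharge m P j) (x j) = 0
        · exact h1.trans (h2 ▸ netReward_le_of_surplus_eq_zero (exploreCharge_nonneg j) hU j hs)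
        · exact (charge_le_max_gittinsIndex hfee1 i (x i)).trans
            (max_le (hx j hs (some i) (by simpa using hij)) (exploreCharge_nonneg j))

/-- All three losses in `slack_eq` vanish: any surplus belongs to the sold product, no charge lies
above its charge, and it is not explored at a negative index. -/
theorem ChargeDominates.slack_eq_zero (hT : ∀ j, 1 ≤ P.entryTime j) (hfee1 : P.fee ≤ 1)
    {x : ι → ProductState} (hx : ChargeDominates m P x) {a : Action ι}
    (ha : ∀ b, actionIndex m P x b ≤ actionIndex m P x a) : slack m P x a = 0 := by
  have h1 : ∀ i, (if a = some i then 0 else surplus m P i (exploreCharge m P i) (x i)) = 0 := by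
    intro i
    split_ifs with hi
    · rfl
    · by_contra h
      exact hi (hx.eq_of_surplus_ne_zero hfee1 ha h)
  have h2 : ∀ y, (if actionCharge m P x a ≤ y then backlog m P x y else 0) = 0 := by
    intro y
    split_ifs with hy
    · rw [backlog, Finset.prod_eq_one fun i _ =>
        drain_of_le ((hx.charge_le_actionCharge hfee1 ha i).trans hy), sub_self]
    · rfl
  have h3 : exploreLoss m P x a = 0 := by
    cases a with
    | none => rfl
    | some j =>
      simp only [exploreLoss]
      split_ifs with hU
      · have h4 : 0 ≤ gittinsIndex m P j (x j) := ha none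
        rw [exploreGain_exploreCharge_eq_zero (hU ▸ h4), neg_zero]
      · rfl
  rw [slack_eq hT hfee1]
  simp [h1, h2, h3]

omit [Fintype ι] in
theorem actionIndex_nextState {Q : Problem} {x : ι → ProductState} {a b : Action ι}
    {o : Signal} (hab : a ≠ b) (hx : ∀ k, b = some k → unsold Q (x k) = x k) :
    actionIndex m P (nextState P Q x a o) b = actionIndex m P x b := by
  cases b with
  | none => rfl
  | some k =>
    change gittinsIndex m P k _ = gittinsIndex m P k _
    rw [nextState_of_ne P Q x hab, hx k rfl]

omit [Fintype ι] in
-- A surplus can arise only by exploration, which had maximal index when it was chosen, and all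
-- other products are frozen. Afterwards the product with the surplus is the one sold, so the
-- comparison persists.
theorem ChargeDominates.nextState (hfee1 : P.fee ≤ 1) {x : ι → ProductState}
    (hx : ChargeDominates m P x) {a : Action ι}
    (ha : ∀ b, actionIndex m P x b ≤ actionIndex m P x a) (o : Signal) :
    ChargeDominates m P (nextState P .rested x a o) := by
  intro i hi b hb
  by_cases hai : a = some i
  · subst hai
    rw [actionIndex_nextState hb.symm fun _ _ => rfl]
    rw [nextState_self] at hi
    by_cases hU : x i = .undeveloped
    · refine (ha b).trans ?_
      change gittinsIndex m P i (x i) ≤ _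
      rw [hU]
      exact le_max_left _ _
    · refine hx i (fun h => hi ?_) b hb
      rw [sell_developed P i hU]
      have h1 := surplus_tick (m := m) (P := P) (κ := exploreCharge m P i) (exploreCharge_nonneg i) hU i
      have h2 := surplus_nonneg (m := m) (P := P) i (exploreCharge m P i) (x i).tick
      have h3 := mul_nonneg m.γ_pos.le h2
      have h4 := le_max_right (netReward m P i (x i) - exploreCharge m P i) 0
      exact (mul_eq_zero.1 (by linarith : m.γ * _ = 0)).resolve_left m.γ_pos.ne'
  · rw [nextState_rested_of_ne P x hai] at hi
    exact absurd (hx.eq_of_surplus_ne_zero hfee1 ha hi) hai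

theorem value_rested_of_isGittins (hT : ∀ j, 1 ≤ P.entryTime j) (hfee1 : P.fee ≤ 1)
    {π : SellerPolicy ι} (hg : IsGittins m P .rested π) :
    value m P .rested π = potential m P fun _ => .undeveloped := by
  refine value_rested_eq_potential fun h hh a ha => ?_
  have hd := Reachable.rec' m P (I := fun h => ChargeDominates m P (stateAfter P .rested h))
    (fun j hj => absurd rfl hj) (fun h hh ih a ha o _ => by
      rw [stateAfter_append]
      exact ih.nextState hfee1 (hg h hh a ha) o) h hh
  exact hd.slack_eq_zero hT hfee1 (hg h hh a ha)

theorem isOptimal_rested_of_isGittins (hT : ∀ j, 1 ≤ P.entryTime j) (hfee1 : P.fee ≤ 1)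
    {π : SellerPolicy ι} (hg : IsGittins m P .rested π) : IsOptimal m P .rested π := fun σ =>
  (value_rested_le hT hfee1 σ).trans (value_rested_of_isGittins hT hfee1 hg).ge

theorem optimal_of_isGittins_of_keepsSelling (hT : ∀ j, 1 ≤ P.entryTime j) (hfee1 : P.fee ≤ 1)
    {Q : Problem} {π : SellerPolicy ι} (hg : IsGittins m P Q π) (hk : KeepsSelling m P Q π) :
    value m P .original π = value m P .rested π ∧ IsOptimal m P .rested π ∧
      IsOptimal m P .original π := by
  have hv := value_eq_of_keepsSelling m P hk
  have ho := isOptimal_rested_of_isGittins hT hfee1 (isGittins_rested m P hg hk)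
  exact ⟨hv, ho, fun σ => (value_original_le m P hfee1 σ).trans ((ho σ).trans hv.ge)⟩

/-- At most one product is good, and no other action has an index above that of exploring it. -/
def GoodDominates (m : Market ι) (P : PlatformPolicy ι) (x : ι → ProductState) : Prop :=
  ∀ j C, x j = .good C → (∀ b, b ≠ some j →
    actionIndex m P x b ≤ gittinsIndex m P j .undeveloped) ∧
      ∀ i C', x i = .good C' → i = j

omit [Fintype ι] in
-- When the good products are being sold, the unsold ones are frozen in either problem. So only the
-- sold product can be good next, and the other indices are those from the time of its exploration.
theorem GoodDominates.nextState {Q : Problem} {x : ι → ProductState} (hx : GoodDominates m P x)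
    {a : Action ι} (ha : ∀ b, actionIndex m P x b ≤ actionIndex m P x a)
    (hs : ∀ j C, x j = .good C → a = some j) (o : Signal) :
    GoodDominates m P (nextState P Q x a o) := by
  have hu : ∀ k, a ≠ some k → unsold Q (x k) = x k := fun k hk =>
    unsold_of_ne_good Q fun C hC => hk (hs k C hC)
  have hgood : ∀ i C, PlatformEntry.nextState P Q x a o i = .good C → a = some i := by
    intro i C hi
    by_contra hai
    rw [nextState_of_ne P Q x hai, hu i hai] at hi
    exact hai (hs i C hi)
  intro j C hj
  have haj := hgood j C hj
  subst haj
  refine ⟨fun b hb => ?_, fun i C' hi => (Option.some.inj (hgood i C' hi)).symm⟩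
  rw [actionIndex_nextState hb.symm fun k hk => hu k (hk ▸ hb.symm)]
  rw [nextState_self] at hj
  by_cases hU : x j = .undeveloped
  · rw [← hU]
    exact ha b
  · rw [sell_developed P j hU] at hj
    cases hxj : x j with
    | undeveloped => exact absurd hxj hU
    | good C' => exact (hx j C' hxj).1 b hb
    | bad => rw [hxj] at hj; exact absurd hj (by simp [ProductState.tick])
    | entered => rw [hxj] at hj; exact absurd hj (by simp [ProductState.tick])

omit [Fintype ι] in
-- The invariant and the selling of good products need each other, so they are proved in one
-- induction; it remains to derive the selling from the invariant at a single history.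
theorem keepsSelling_of_isGittins {Q : Problem} {π : SellerPolicy ι} (hg : IsGittins m P Q π)
    (hs : ∀ h, Reachable m P Q π h → GoodDominates m P (stateAfter P Q h) →
      ∀ j C, stateAfter P Q h j = .good C → ∀ a ∈ (π h).support, a = some j) :
    KeepsSelling m P Q π := by
  intro h hh
  refine hs h hh (Reachable.rec' m P (I := fun h => GoodDominates m P (stateAfter P Q h))
    (fun j C hj => absurd hj (by simp [stateAfter_nil])) (fun h hh ih a ha o _ => ?_) h hh)
  rw [stateAfter_append]
  exact ih.nextState (hg h hh a ha) (fun j C hj => hs h hh ih j C hj a ha) o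

theorem exists_isGittins_keepsSelling (hfee1 : P.fee ≤ 1) (Q : Problem) :
    ∃ π, IsGittins m P Q π ∧ KeepsSelling m P Q π := by
  -- Ties are broken in favour of a good product, since exploring another product may have the same
  -- index.
  have hex : ∀ x : ι → ProductState, ∃ a, (∀ b, actionIndex m P x b ≤ actionIndex m P x a) ∧
      ((∃ j C, x j = .good C ∧ ∀ b, actionIndex m P x b ≤ actionIndex m P x (some j)) →
        ∃ j C, x j = .good C ∧ a = some j) := by
    intro x
    by_cases hx : ∃ j C, x j = .good C ∧ ∀ b, actionIndex m P x b ≤ actionIndex m P x (some j)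
    · obtain ⟨j, C, hj, hb⟩ := hx
      exact ⟨some j, hb, fun _ => ⟨j, C, hj, rfl⟩⟩
    · obtain ⟨a, ha⟩ := Finite.exists_max (actionIndex m P x)
      exact ⟨a, ha, fun h => absurd h hx⟩
  choose f hf hf' using hex
  have hg : IsGittins m P Q fun h => PMF.pure (f (stateAfter P Q h)) := by
    intro h _ a ha b
    rw [PMF.support_pure, Set.mem_singleton_iff] at ha
    rw [ha]
    exact hf _ b
  refine ⟨_, hg, keepsSelling_of_isGittins hg fun h _ hd j C hj a ha => ?_⟩
  rw [PMF.support_pure, Set.mem_singleton_iff] at ha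
  have hmax : ∀ b, actionIndex m P (stateAfter P Q h) b ≤
      actionIndex m P (stateAfter P Q h) (some j) := by
    intro b
    by_cases hb : b = some j
    · rw [hb]
    · refine ((hd j C hj).1 b hb).trans ((gittinsIndex_undeveloped_le hfee1 j).trans ?_)
      change _ ≤ gittinsIndex m P j _
      rw [hj, gittinsIndex_developed hfee1 (by simp)]
      exact le_rfl
  obtain ⟨i, C', hi, hai⟩ := hf' _ ⟨j, C, hj, hmax⟩
  rw [ha, hai, (hd j C hj).2 i C' hi]

omit [Fintype ι] in
theorem keepsSelling_of_isGittins_of_lt (hfee1 : P.fee ≤ 1)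
    (hlt : ∀ j, 0 < m.c j ∨ (m.p j < 1 ∧ P.fee < 1)) {Q : Problem} {π : SellerPolicy ι}
    (hg : IsGittins m P Q π) : KeepsSelling m P Q π := by
  refine keepsSelling_of_isGittins hg fun h hh hd j C hj a ha => ?_
  by_contra haj
  have h1 := (hd j C hj).1 a haj
  have h2 : (1 - P.fee) * m.rg j ≤ actionIndex m P (stateAfter P Q h) a := by
    refine le_trans ?_ (hg h hh a ha (some j))
    change _ ≤ gittinsIndex m P j _
    rw [hj, gittinsIndex_developed hfee1 (by simp)]
    exact le_rfl
  exact absurd (h2.trans h1) (not_le.2 (gittinsIndex_undeveloped_lt hfee1 (hlt j)))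

theorem keepsSelling_of_isOptimal (hT : ∀ j, 1 ≤ P.entryTime j) (hfee1 : P.fee ≤ 1)
    (hlt : ∀ j, 0 < m.c j ∨ (m.p j < 1 ∧ P.fee < 1)) {π : SellerPolicy ι}
    (ho : IsOptimal m P .original π) : KeepsSelling m P .original π := by
  obtain ⟨σ, hσg, hσk⟩ := exists_isGittins_keepsSelling (m := m) hfee1 .rested
  -- An index policy that keeps selling carries the rested optimum over to the original problem, and
  -- `π` does at least as well there.
  have hv : value m P .rested π = potential m P fun _ => .undeveloped := by
    refine le_antisymm (value_rested_le hT hfee1 π) ?_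
    rw [← value_rested_of_isGittins hT hfee1 hσg, ← value_eq_of_keepsSelling m P hσk]
    exact (ho σ).trans (value_original_le m P hfee1 π)
  have hslack := fun h (hh : Reachable m P .rested π h) a (ha : a ∈ (π h).support) =>
    of_slack_eq_zero hT hfee1 (slack_eq_zero_of_value_eq hT hfee1 hv hh ha)
  -- A developed product has been explored on the way, and that exploration was free of loss.
  have hexp : ∀ h, Reachable m P .rested π h → ∀ j, stateAfter P .rested h j ≠ .undeveloped →
      exploreGain m P j (exploreCharge m P j) = 0 := by
    refine Reachable.rec' m P (I := fun h => ∀ j, stateAfter P .rested h j ≠ .undeveloped →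
      exploreGain m P j (exploreCharge m P j) = 0) (fun j hj => absurd rfl hj) ?_
    intro h hh ih a ha o _ j hj
    by_cases hU : stateAfter P .rested h j = .undeveloped
    · by_cases haj : a = some j
      · subst haj
        have h1 := (hslack h hh _ ha).2
        rw [exploreLoss, if_pos hU] at h1
        exact neg_eq_zero.1 h1
      · rw [stateAfter_append, nextState_rested_of_ne P _ haj] at hj
        exact absurd hU hj
    · exact ih j hU
  intro h hh j C hj a ha
  have hh' := (reachable_iff m P .original .rested π h).1 hh
  obtain ⟨C', hC'⟩ : ∃ C', stateAfter P .rested h j = .good C' := by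
    rcases behind_stateAfter P h j with he | ⟨C', hC', -⟩
    · exact ⟨C, he.trans hj⟩
    · exact ⟨C', hC'⟩
  by_contra haj
  have h1 := (hslack h hh' a ha).1 j haj
  rw [hC'] at h1
  have h2 := netReward_le_of_surplus_eq_zero (exploreCharge_nonneg j) (by simp) j h1
  -- Leaving the product unsold without loss means that it has no surplus, which pushes its charge
  -- up to the good reward. There exploring loses strictly, against `hexp`.
  have h3 : exploreCharge m P j = (1 - P.fee) * m.rg j :=
    le_antisymm (exploreCharge_le hfee1 j) h2
  have h4 := hexp h hh' j (by simp [hC'])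
  rw [h3] at h4
  exact (exploreGain_netReward_good_neg hfee1 (hlt j)).ne h4

end Policies

end PlatformEntry

theorem mainTheorem1 {ι : Type*} [Fintype ι] [DecidableEq ι]
    (m : PlatformEntry.Market ι) (P : PlatformEntry.PlatformPolicy ι)
    (hT : ∀ j, 1 ≤ P.entryTime j) (hfee0 : 0 ≤ P.fee) (hfee1 : P.fee ≤ 1) :
    -- in the actual problem an unsold good product changes its state ...
    (∀ (x : ι → PlatformEntry.ProductState) a o j C, x j = .good C → a ≠ some j →
      PlatformEntry.nextState P .original x a o j ≠ x j) ∧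
    -- ... whereas no unsold product does in the rested problem
    (∀ (x : ι → PlatformEntry.ProductState) a o j, a ≠ some j →
      PlatformEntry.nextState P .rested x a o j = x j) ∧
    -- the rested problem weakly dominates, policy by policy
    (∀ π, PlatformEntry.value m P .original π ≤ PlatformEntry.value m P .rested π) ∧
    -- the two problems coincide if good products are sold until entry
    (∀ Q π, PlatformEntry.KeepsSelling m P Q π →
      (∀ h, PlatformEntry.Reachable m P .original π h ↔ PlatformEntry.Reachable m P .rested π h) ∧
      (∀ h, PlatformEntry.Reachable m P .original π h →
        PlatformEntry.stateAfter P .original h = PlatformEntry.stateAfter P .rested h) ∧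
      PlatformEntry.value m P .original π = PlatformEntry.value m P .rested π) ∧
    -- these policies are the ones under which the products stay independent
    (∀ π, PlatformEntry.PreservesIndependence m P π ↔
      PlatformEntry.KeepsSelling m P .original π) ∧
    -- Gittins-index policies are optimal in the rested problem
    (∀ π, PlatformEntry.IsGittins m P .rested π → PlatformEntry.IsOptimal m P .rested π) ∧
    -- some Gittins-index policy sells good products until entry
    (∀ Q, ∃ π, PlatformEntry.IsGittins m P Q π ∧ PlatformEntry.KeepsSelling m P Q π) ∧
    -- each such policy attains the rested value and is optimal in the actual problem
    (∀ Q π, PlatformEntry.IsGittins m P Q π → PlatformEntry.KeepsSelling m P Q π →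
      PlatformEntry.value m P .original π = PlatformEntry.value m P .rested π ∧
      PlatformEntry.IsOptimal m P .rested π ∧ PlatformEntry.IsOptimal m P .original π) ∧
    -- unless a product is free and cannot fail, or free under a full fee, every Gittins-index
    -- policy and every optimal policy is of this kind
    ((∀ j, 0 < m.c j ∨ (m.p j < 1 ∧ P.fee < 1)) →
      (∀ Q π, PlatformEntry.IsGittins m P Q π →
        PlatformEntry.KeepsSelling m P Q π ∧ PlatformEntry.PreservesIndependence m P π ∧
        PlatformEntry.value m P .original π = PlatformEntry.value m P .rested π ∧
        PlatformEntry.IsOptimal m P .rested π ∧ PlatformEntry.IsOptimal m P .original π) ∧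
      (∀ π, PlatformEntry.IsOptimal m P .original π →
        PlatformEntry.PreservesIndependence m P π)) := by
  open PlatformEntry in
  refine ⟨fun x a o j C hC ha => ?_, fun x a o j ha => nextState_rested_of_ne P x ha o,
    value_original_le m P hfee1, fun Q π hk => ⟨reachable_iff m P _ _ π, fun h hh =>
      stateAfter_eq_of_keepsSelling m P hk h ((reachable_iff m P _ _ π h).1 hh),
      value_eq_of_keepsSelling m P hk⟩, preservesIndependence_iff m P,
    fun π => isOptimal_rested_of_isGittins hT hfee1, exists_isGittins_keepsSelling hfee1,
    fun Q π => optimal_of_isGittins_of_keepsSelling hT hfee1, fun hlt => ⟨fun Q π hg => ?_,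
      fun π ho => (preservesIndependence_iff m P π).2
        (keepsSelling_of_isOptimal hT hfee1 hlt ho)⟩⟩
  · rw [PlatformEntry.nextState_of_ne P _ x ha, hC]
    exact PlatformEntry.tick_good_ne C
  · have hk := PlatformEntry.keepsSelling_of_isGittins_of_lt hfee1 hlt hg
    have ho := PlatformEntry.optimal_of_isGittins_of_keepsSelling hT hfee1 hg hk
    refine ⟨hk, (PlatformEntry.preservesIndependence_iff m P π).2 fun h hh j C hj => ?_, ho⟩
    have hh' := (PlatformEntry.reachable_iff m P .original Q π h).1 hh
    refine hk h hh' j C ?_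
    -- Independence is about the original states; if the policy keeps selling in the rested problem,
    -- the states agree along the history.
    cases Q
    · exact hj
    · rw [← PlatformEntry.stateAfter_eq_of_keepsSelling m P hk h hh']
      exact hj
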